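/- **Theorem 3 (cluster representation improves risk).** *Setting.* Let $X=[0,1]^n$, $Y=\{0,1\}$, $L(y,y')=\mathbf 1(y\ne y')$, and let $P=P_{XY}$ be a probability distribution on $X\times Y$ with marginal $P_X$; a point is *supported* if it lies in the (topological) support of the distribution. Let $\delta>0$, $\varepsilon_E\in(0,\tfrac12]$, let $s=1/N$ with $N\ge 1$ an integer, divide $X$ into the $s^{-n}$ grid hypercubes of side $s$, and let $\gamma:=s\sqrt n$ (the diameter of a hypercube). Let $S_u\sim P_X^{m_u}$ and, independently, $S_l\sim P_{XY}^{m_l}$. For a classifier $h$ write $R(h)=\mathbb E_{(x,y)\sim P_{XY}}L(h(x),y)$. *Cluster test.* Join two points of $S_u$ by an edge if their Euclidean distance is at most $\gamma$. For each component $C_i$ of this graph let $X_i$ be the union of the grid hypercubes that contain a point of $C_i$, and let $X_a$ be the set of these regions. If $|X_a|\ge 2$ the test passes, with $\hat R_a(P_X)=0$ and output $X_a$, and $k:=|X_a|$; otherwise it fails. *Learners.* If the test passes, the feature map $f:X\to Z=\mathbb R^k$ sends the points of the $i$-th region to the $i$-th unit vector, and points in no region to $0$. The hypothesis $h$ is any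 empirical risk minimizer over all (affine) linear classifiers $X\to Y$ on $S_l$, and $h^Z$ any empirical risk minimizer over all (affine) linear classifiers $Z\to Y$ on $\{(f(x),y):(x,y)\in S_l\}$. *Cluster-label assumption.* Let $\mathcal X_A$ be the set of families of $k'\ge 2$ regions $X_1,\dots,X_{k'}\subseteq X$ such that each $X_i$ is the union of the grid hypercubes of the points of some nonempty set $T_i$ of supported points of $X$, points of $T_i$ and $T_j$ are more than $\gamma$ apart for $i\neq j$, and every point of a region is within $\gamma$ of a supported point. Let $R_A(P_X)$ be the minimum of $P_X(X\setminus\bigcup_iX_i)$ over $\mathcal X_A$ ($+\infty$ if $\mathcal X_A=\emptyset$), and let $\varepsilon_A:=\frac1{m_u}\big(s^{-n}\log 2+\log\frac3\delta\big)$. Let $d_\gamma(x,x')=0$ if some finite path of supported points with steps of length at most $\gamma$ leads from $x$ to $x'$, and $d_\gamma(x,x')=1$ otherwise. For a distribution $Q$ on $X\times Y$ let $R_B(Q)$ be the probability that two independent draws $(x,y),(x',y')$ from $Q$ satisfy $d_\gamma(x,x')=0$ and $y\ne y'$ ($d_\gamma$ being taken for the marginal of $Q$). Assume: if $R_A(P_X)\le\varepsilon_A$,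 then $R_B(P_{XY})=0$. *Label-balance assumption.* Labels are named so that $P(y=0)\ge P(y=1)$; assume $R_E(P_{XY}):=P(y=1)\ge\varepsilon_E$. *Empirical lower bound $\beta$.* Call labels $(y_i)$ of $S_u=(x_i)$ admissible if some distribution $Q$ on $X\times Y$ has marginal $P_X$, $R_B(Q)=0$, $Q(y=0)\ge Q(y=1)\ge\varepsilon_E$, and all $(x_i,y_i)$ in its support. Let $\beta$ be any real number that is a lower bound, over all admissible labelings, on the empirical risk of an empirical risk minimizer over the linear classifiers $X\to Y$ on $S_u$ so labeled. *Conclusion.* Let $$\varepsilon_{\min}(\beta)=\beta-\sqrt{\frac{8(n+1)\log\frac{2em_u}{n+1}+8\log\frac{12}{\delta}}{m_u}},\qquad \varepsilon^Z_{\max}=\frac{s^{-n}\log2+\log\frac3\delta}{m_u}+\max_{t\in[0,1]}\Big(k+1-\frac\delta3(1-t)^{-m_l}\Big)t .$$ With probability at least $1-\delta$ over $(S_u,S_l)$: if the test passes, then for all such $h$, $h^Z$ and $\beta$, $$R(h)-R(h^Z\circ f)\ \ge\ \varepsilon_{\min}(\beta)-\varepsilon^Z_{\max};$$ moreover, if $\varepsilon_A<\varepsilon_E$,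 the same inequality holds with $\beta$ replaced by $\min_{i\ne j}\min_{g}\frac1{m_u}\#\{x\in S_u\cap(X_i\cup X_j): g(x)\ne \mathbf 1(x\in X_i)\}$, where $i,j$ range over the regions in $X_a$ and $g$ over the linear classifiers $X\to Y$. (A square root of a negative number is read as $0$.) -/

import Mathlib

open MeasureTheory
open scoped ENNReal

noncomputable section

namespace ClusterLearning

/-! ### Linear classifiers, risk, empirical risk minimization -/

/-- Zero/one loss on the label set `{0, 1}`. -/
def zeroOneLoss (y y' : Fin 2) : ℝ := if y ≠ y' then 1 else 0

/-- The (affine) linear classifiers `z ↦ 1[⟨w, z⟩ + b ≥ 0]` on `ℝ^ι`. -/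
def linearClassifiers (ι : Type*) [Fintype ι] : Set (EuclideanSpace ℝ ι → Fin 2) :=
  {h | ∃ (w : EuclideanSpace ℝ ι) (b : ℝ), ∀ z, h z = if 0 ≤ inner ℝ w z + b then 1 else 0}

/-- The risk `R(h) = 𝔼_{(x,y) ∼ P} [L(h(x), y)]`. -/
def risk {E : Type*} [MeasurableSpace E] (P : Measure (E × Fin 2)) (h : E → Fin 2) : ℝ :=
  ∫ z, zeroOneLoss (h z.1) z.2 ∂P

/-- Average zero/one loss of `h` on a labeled sample. -/
def empRisk {E : Type*} {m : ℕ} (S : Fin m → E × Fin 2) (h : E → Fin 2) : ℝ :=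
  (∑ i, zeroOneLoss (h (S i).1) (S i).2) / m

/-- `h` is a result of empirical risk minimization over the class `H` on the sample `S`. -/
def IsERM {E : Type*} {m : ℕ} (H : Set (E → Fin 2)) (S : Fin m → E × Fin 2)
    (h : E → Fin 2) : Prop :=
  h ∈ H ∧ ∀ g ∈ H, empRisk S h ≤ empRisk S g

/-! ### The hypercube grid and the cluster property test -/

/-- The input space `[0,1]^n`. -/
def unitCube (n : ℕ) : Set (EuclideanSpace ℝ (Fin n)) := {x | ∀ i, x i ∈ Set.Icc (0 : ℝ) 1}

/-- Index of the grid interval of length `s` containing `t ∈ [0,1]`, where `1/s` is an integer.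
The intervals are half-open, except that the last one also contains `1`. -/
def gridIndex (s t : ℝ) : ℕ := min ⌊t / s⌋₊ (⌊1 / s⌋₊ - 1)

/-- The grid hypercube `c_x` of side `s` containing the point `x` of the unit cube. -/
def cell {n : ℕ} (s : ℝ) (x : EuclideanSpace ℝ (Fin n)) : Set (EuclideanSpace ℝ (Fin n)) :=
  {x' ∈ unitCube n | ∀ i, gridIndex s (x' i) = gridIndex s (x i)}

/-- The cluster separation parameter: the diameter of a hypercube of side `s`. -/
def sepParam (n : ℕ) (s : ℝ) : ℝ := s * √n

/-- The graph on the sample: an edge joins two sample points at distance at most `γ`. -/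
def sampleGraph {n m : ℕ} (s : ℝ) (S : Fin m → EuclideanSpace ℝ (Fin n)) :
    SimpleGraph (Fin m) where
  Adj i j := i ≠ j ∧ dist (S i) (S j) ≤ sepParam n s
  symm := ⟨fun _ _ h => ⟨h.1.symm, dist_comm (S _) (S _) ▸ h.2⟩⟩
  loopless := ⟨fun _ h => h.1 rfl⟩

/-- The union of the hypercubes of all sample points in the graph component of the `i`-th one. -/
def region {n m : ℕ} (s : ℝ) (S : Fin m → EuclideanSpace ℝ (Fin n)) (i : Fin m) :
    Set (EuclideanSpace ℝ (Fin n)) :=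
  ⋃ j ∈ {j | (sampleGraph s S).Reachable i j}, cell s (S j)

open Classical in
/-- The set of the regions of all components. -/
def regions {n m : ℕ} (s : ℝ) (S : Fin m → EuclideanSpace ℝ (Fin n)) :
    Finset (Set (EuclideanSpace ℝ (Fin n))) :=
  Finset.univ.image (region s S)

/-- The property test. It returns the set of regions together with the empirical estimate `0`
if there are at least two regions, and failure (`none`) otherwise. -/
def clusterTest {n m : ℕ} (s : ℝ) (S : Fin m → EuclideanSpace ℝ (Fin n)) :
    Option (Finset (Set (EuclideanSpace ℝ (Fin n))) × ℝ) :=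
  if 2 ≤ (regions s S).card then some (regions s S, 0) else none

open Classical in
/-- The one-hot feature map. The feature space is `ℝ^k`, with its `k` coordinates indexed by the
`k` regions; points in no region are sent to the zero vector. -/
def featureMap {n : ℕ} (Xa : Finset (Set (EuclideanSpace ℝ (Fin n))))
    (x : EuclideanSpace ℝ (Fin n)) : EuclideanSpace ℝ Xa :=
  WithLp.toLp 2 fun A => if x ∈ A.1 then 1 else 0

/-! ### Properties of the marginal and of the joint distribution -/

/-- The property class: families of `k ≥ 2` regions, each the union of the grid hypercubes around
some points supported by `μ`, where the points that generate different regions are more than `γ`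
apart, and where all points of a region are within `γ` of a point supported by `μ`. -/
def IsClusterFamily {n : ℕ} (s : ℝ) (μ : Measure (EuclideanSpace ℝ (Fin n))) {k : ℕ}
    (X : Fin k → Set (EuclideanSpace ℝ (Fin n))) : Prop :=
  2 ≤ k ∧
  (∃ T : Fin k → Set (EuclideanSpace ℝ (Fin n)),
    (∀ i, (T i).Nonempty ∧ T i ⊆ μ.support ∩ unitCube n ∧ X i = ⋃ t ∈ T i, cell s t) ∧
    ∀ i j, i ≠ j → ∀ t ∈ T i, ∀ t' ∈ T j, sepParam n s < dist t t') ∧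
  ∀ i, ∀ x ∈ X i, ∃ x' ∈ μ.support, dist x x' ≤ sepParam n s

/-- `R_A(μ)`: the least mass that a family of the property class leaves uncovered
(`∞` if the class is empty). -/
def riskA {n : ℕ} (s : ℝ) (μ : Measure (EuclideanSpace ℝ (Fin n))) : ℝ≥0∞ :=
  ⨅ (k : ℕ) (X : Fin k → Set (EuclideanSpace ℝ (Fin n))) (_ : IsClusterFamily s μ X),
    μ (⋃ i, X i)ᶜ

/-- `d_γ(x, x') = 0`: a finite path of points supported by `μ`, with steps of length at most `γ`,
leads from `x` to `x'`. -/
def GammaConnected {n : ℕ} (s : ℝ) (μ : Measure (EuclideanSpace ℝ (Fin n)))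
    (x x' : EuclideanSpace ℝ (Fin n)) : Prop :=
  ∃ (G : ℕ) (q : ℕ → EuclideanSpace ℝ (Fin n)), q 0 = x ∧ q G = x' ∧
    (∀ i < G, dist (q i) (q (i + 1)) ≤ sepParam n s) ∧ ∀ i ≤ G, q i ∈ μ.support

/-- `R_B(P)`: the probability that two independent draws from `P` are connected and have
different labels. -/
def riskB {n : ℕ} (s : ℝ) (P : Measure (EuclideanSpace ℝ (Fin n) × Fin 2)) : ℝ≥0∞ :=
  (P.prod P) {z | GammaConnected s P.fst z.1.1 z.2.1 ∧ z.1.2 ≠ z.2.2}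

/-- `R_E(P) = P(y = 1)`. -/
def riskE {n : ℕ} (P : Measure (EuclideanSpace ℝ (Fin n) × Fin 2)) : ℝ≥0∞ :=
  P {z | z.2 = 1}

/-- The condition `R_E(P) ≥ ε_E`, for `P` with labels named so that `P(y = 0) ≥ P(y = 1)`. -/
def LabelBalanced {n : ℕ} (εE : ℝ) (P : Measure (EuclideanSpace ℝ (Fin n) × Fin 2)) : Prop :=
  P {z | z.2 = 1} ≤ P {z | z.2 = 0} ∧ ENNReal.ofReal εE ≤ riskE P

/-! ### Lower bounds on the empirical risk in the input space -/

/-- The labels `y` of the unlabeled sample `S` may arise from some joint distribution that has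
marginal `μ`, agrees with the cluster structure and is label balanced. -/
def IsAdmissibleLabeling {n m : ℕ} (s εE : ℝ) (μ : Measure (EuclideanSpace ℝ (Fin n)))
    (S : Fin m → EuclideanSpace ℝ (Fin n)) (y : Fin m → Fin 2) : Prop :=
  ∃ Q : Measure (EuclideanSpace ℝ (Fin n) × Fin 2), IsProbabilityMeasure Q ∧ Q.fst = μ ∧
    riskB s Q = 0 ∧ LabelBalanced εE Q ∧ ∀ i, (S i, y i) ∈ Q.support

/-- `β` is a lower bound on the empirical risk of a linear classifier learned by empirical risk
minimization on `S` with any admissible labels. -/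
def IsEmpRiskLowerBound {n m : ℕ} (s εE : ℝ) (μ : Measure (EuclideanSpace ℝ (Fin n)))
    (S : Fin m → EuclideanSpace ℝ (Fin n)) (β : ℝ) : Prop :=
  ∀ y : Fin m → Fin 2, IsAdmissibleLabeling s εE μ S y →
    ∀ h, IsERM (linearClassifiers (Fin n)) (fun i => (S i, y i)) h →
      β ≤ empRisk (fun i => (S i, y i)) h

open Classical in
/-- `m⁻¹` times the number of errors that `h` makes on the points of `S` in `A ∪ B`, where points
in `A` are labeled `1` and the others `0`. -/
def pairRisk {n m : ℕ} (S : Fin m → EuclideanSpace ℝ (Fin n))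
    (A B : Set (EuclideanSpace ℝ (Fin n))) (h : EuclideanSpace ℝ (Fin n) → Fin 2) : ℝ :=
  (∑ i with S i ∈ A ∪ B, zeroOneLoss (h (S i)) (if S i ∈ A then 1 else 0)) / m

/-- The least pairwise error: the minimum over pairs of distinct regions of the least error of a
linear classifier that has to tell the two regions apart. -/
def pairBeta {n m : ℕ} (S : Fin m → EuclideanSpace ℝ (Fin n))
    (Xa : Finset (Set (EuclideanSpace ℝ (Fin n)))) : ℝ :=
  sInf {r | ∃ A ∈ Xa, ∃ B ∈ Xa, A ≠ B ∧ ∃ h ∈ linearClassifiers (Fin n), r = pairRisk S A B h}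

/-! ### The bounds -/

/-- `ε_A = (s⁻ⁿ log 2 + log (3/δ)) / m_u`. -/
def epsA (n mu : ℕ) (s δ : ℝ) : ℝ := ((s ^ n)⁻¹ * Real.log 2 + Real.log (3 / δ)) / mu

/-- `max_{t ∈ [0,1]} (k + 1 - (δ/3) (1-t)^{-m_l}) t`. At `t = 1` the function is `-∞` (for
`m_l > 0`) or a limit of its values at `t < 1` (for `m_l = 0`), so `t = 1` may be left out. -/
def alphaBound (k ml : ℕ) (δ : ℝ) : ℝ :=
  sSup ((fun t : ℝ => (k + 1 - δ / 3 * ((1 - t) ^ ml)⁻¹) * t) '' Set.Ico 0 1)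

/-- The upper bound `ε_max^Z` on the risk with learned features. -/
def epsMaxZ (n mu ml k : ℕ) (s δ : ℝ) : ℝ := epsA n mu s δ + alphaBound k ml δ

/-- The lower bound `ε_min` on the risk in the original input space. -/
def epsMin (n mu : ℕ) (δ β : ℝ) : ℝ :=
  β - √((8 * (n + 1) * Real.log (2 * Real.exp 1 * mu / (n + 1)) + 8 * Real.log (12 / δ)) / mu)

end ClusterLearning

end

/-! The two risks are compared with intermediate quantities, on the complement of an event of
probability at most `5δ/6`.

If the test passes, the sample points behind each region witness that the regions form a family of
the property class (`riskA_le_measure_compl`). There are at most `2 ^ (N ^ n)` sets of hit cells, so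
a union bound makes the mass outside the regions at most `ε_A`, up to probability `δ/3`
(`measure_uncovered_grid_le`). Hence `R_A ≤ ε_A`, and the cluster-label assumption gives `R_B = 0`:
two supported points of one region are joined by a path through sample points, so almost surely a
region carries a single label (`measure_region_label_eq_zero`).

Upper bound for `h^Z`: on one-hot features, linear classifiers realize every labeling of the regions
and of the rest, so empirical risk minimization is right on each region that `S_l` hits. Errors are
confined to the uncovered part and to the regions not hit (`risk_comp_featureMap_le`). The heaviest
regions are all hit by a union bound, and what is left weighs at most `alphaBound`, up to
probability `δ/3` (`measure_unseen_mass_gt_le`).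

Lower bound for `h`: although `h` is learned on `S_l`, it is a linear classifier, so its risk is at
least its empirical risk on a labeled `S_u` minus the Vapnik-Chervonenkis width
(`measure_exists_linear_deviation_le`). The labels of `S_u` are never drawn; if every regular
labeling of `S_u` violated this, so would random labels, hence a good labeling exists up to
probability `δ/6` (`measure_atypical_labeling_le`). It is admissible with `Q = P`, so that empirical
risk is at least `β`. If `ε_A < ε_E`, both labels are too heavy to hide outside the regions, so two
regions have different labels and the least pairwise error is a lower bound too. -/

/-! ### Uniform deviation of frequencies over a countable family of events -/

section UniformDeviation

open ProbabilityTheory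

/-- The sign `1` or `-1` that belongs to a Boolean. -/
def boolSign (b : Bool) : ℝ := if b then -1 else 1

/-- Chernoff bound for the number of sign vectors with a large weighted sum. -/
theorem card_signs_le {m : ℕ} (hm : 0 < m) (c : Fin m → ℝ) (hc : ∀ i, |c i| ≤ 1) {t : ℝ}
    (ht : 0 ≤ t) :
    ((Finset.univ.filter fun σ : Fin m → Bool => t < ∑ i, boolSign (σ i) * c i).card : ℝ)
      ≤ 2 ^ m * Real.exp (-t ^ 2 / (2 * m)) := by
  classical
  have hm' : (0 : ℝ) < m := by exact_mod_cast hm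
  -- This value minimizes the Chernoff exponent `m * l ^ 2 / 2 - l * t`.
  set l : ℝ := t / m with hl
  have hl0 : 0 ≤ l := by positivity
  have h1 : ((Finset.univ.filter fun σ : Fin m → Bool => t < ∑ i, boolSign (σ i) * c i).card : ℝ)
      ≤ ∑ σ : Fin m → Bool, Real.exp (l * (∑ i, boolSign (σ i) * c i) - l * t) := by
    rw [Finset.card_eq_sum_ones, Nat.cast_sum, Finset.sum_filter]
    refine Finset.sum_le_sum fun σ _ => ?_
    split_ifs with h
    · rw [Nat.cast_one]
      refine Real.one_le_exp ?_
      nlinarith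
    · positivity
  refine h1.trans ?_
  have h2 : ∀ σ : Fin m → Bool, Real.exp (l * (∑ i, boolSign (σ i) * c i) - l * t)
      = Real.exp (-(l * t)) * ∏ i, Real.exp (boolSign (σ i) * (l * c i)) := by
    intro σ
    rw [← Real.exp_sum, ← Real.exp_add, Finset.mul_sum]
    congr 1
    rw [sub_eq_neg_add]
    congr 1
    exact Finset.sum_congr rfl fun i _ => by ring
  simp_rw [h2]
  rw [← Finset.mul_sum, ← Fintype.prod_sum (fun i (b : Bool) => Real.exp (boolSign b * (l * c i)))]
  have h3 : ∏ i, ∑ b : Bool, Real.exp (boolSign b * (l * c i))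
      ≤ ∏ _i : Fin m, (2 * Real.exp (l ^ 2 / 2)) := by
    refine Finset.prod_le_prod (fun i _ => by positivity) fun i _ => ?_
    have h4 : ∑ b : Bool, Real.exp (boolSign b * (l * c i)) = 2 * Real.cosh (l * c i) := by
      rw [Fintype.sum_bool, Real.cosh_eq]
      simp [boolSign]
      ring
    rw [h4]
    refine mul_le_mul_of_nonneg_left ((Real.cosh_le_exp_half_sq _).trans ?_) (by norm_num)
    rw [Real.exp_le_exp]
    have : (c i) ^ 2 ≤ 1 := (sq_le_one_iff_abs_le_one _).2 (hc i)
    have : (l * c i) ^ 2 ≤ l ^ 2 := by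
      rw [mul_pow]
      nlinarith [sq_nonneg l]
    linarith
  calc Real.exp (-(l * t)) * ∏ i, ∑ b : Bool, Real.exp (boolSign b * (l * c i))
      ≤ Real.exp (-(l * t)) * ∏ _i : Fin m, (2 * Real.exp (l ^ 2 / 2)) :=
        mul_le_mul_of_nonneg_left h3 (Real.exp_pos _).le
    _ = 2 ^ m * (Real.exp (-(l * t)) * Real.exp (m * (l ^ 2 / 2))) := by
        rw [Finset.prod_const, Finset.card_univ, Fintype.card_fin, mul_pow, ← Real.exp_nat_mul]
        ring
    _ = 2 ^ m * Real.exp (-t ^ 2 / (2 * m)) := by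
        rw [← Real.exp_add]
        congr 2
        rw [hl]
        field_simp
        ring

variable {Ω : Type*} {ι : Type*}

/-- The number of sample points in `A`. -/
noncomputable def hits {m : ℕ} (A : Set Ω) (z : Fin m → Ω) : ℝ := ∑ i, A.indicator 1 (z i)

/-- The traces of the family `A` on the points `u`. -/
def traces {κ : Type*} (A : ι → Set Ω) (u : κ → Ω) : Set (Set κ) :=
  Set.range fun j => {k | u k ∈ A j}

open Classical in
/-- For a fixed double sample, few of the exchanges of paired points lead to a large difference. -/
theorem card_swaps_le {m : ℕ} (hm : 0 < m) (A : ι → Set Ω) {B : ℝ}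
    (hB : ∀ u : Fin m ⊕ Fin m → Ω, ((traces A u).ncard : ℝ) ≤ B) {t : ℝ} (ht : 0 ≤ t)
    (w : Fin m → Ω × Ω) :
    ((Finset.univ.filter fun σ : Fin m → Bool => ∃ j, t < ∑ i, boolSign (σ i) *
      ((A j).indicator (1 : Ω → ℝ) (w i).1 - (A j).indicator 1 (w i).2)).card : ℝ)
      ≤ B * (2 ^ m * Real.exp (-t ^ 2 / (2 * m))) := by
  set u : Fin m ⊕ Fin m → Ω := Sum.elim (fun i => (w i).1) (fun i => (w i).2) with hu
  have hfin : (traces A u).Finite := Set.toFinite _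
  -- The signed sum for `A j` depends only on the trace of `A j` on the `2m` points, so the union
  -- over `j` collapses to at most `B` sign problems.
  let c : Set (Fin m ⊕ Fin m) → Fin m → ℝ := fun V i =>
    V.indicator 1 (Sum.inl i) - V.indicator 1 (Sum.inr i)
  have hsub : (Finset.univ.filter fun σ : Fin m → Bool => ∃ j, t < ∑ i, boolSign (σ i) *
      ((A j).indicator (1 : Ω → ℝ) (w i).1 - (A j).indicator 1 (w i).2))
      ⊆ hfin.toFinset.biUnion fun V =>
        Finset.univ.filter fun σ : Fin m → Bool => t < ∑ i, boolSign (σ i) * c V i := by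
    intro σ hσ
    obtain ⟨j, hj⟩ := (Finset.mem_filter.1 hσ).2
    refine Finset.mem_biUnion.2 ⟨{k | u k ∈ A j}, hfin.mem_toFinset.2 ⟨j, rfl⟩, ?_⟩
    refine Finset.mem_filter.2 ⟨Finset.mem_univ _, hj.trans_eq ?_⟩
    refine Finset.sum_congr rfl fun i _ => ?_
    rfl
  have hbound : ∀ V ∈ hfin.toFinset,
      ((Finset.univ.filter fun σ : Fin m → Bool => t < ∑ i, boolSign (σ i) * c V i).card : ℝ)
        ≤ 2 ^ m * Real.exp (-t ^ 2 / (2 * m)) := by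
    intro V _
    refine card_signs_le hm (c V) (fun i => ?_) ht
    by_cases h1 : Sum.inl i ∈ V <;> by_cases h2 : Sum.inr i ∈ V <;> simp [c, h1, h2]
  calc _ ≤ ((hfin.toFinset.biUnion fun V => Finset.univ.filter fun σ : Fin m → Bool =>
          t < ∑ i, boolSign (σ i) * c V i).card : ℝ) := by
        exact_mod_cast Finset.card_le_card hsub
    _ ≤ ∑ V ∈ hfin.toFinset, ((Finset.univ.filter fun σ : Fin m → Bool =>
          t < ∑ i, boolSign (σ i) * c V i).card : ℝ) := by
        exact_mod_cast Finset.card_biUnion_le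
    _ ≤ ∑ _V ∈ hfin.toFinset, 2 ^ m * Real.exp (-t ^ 2 / (2 * m)) := Finset.sum_le_sum hbound
    _ = ((traces A u).ncard : ℝ) * (2 ^ m * Real.exp (-t ^ 2 / (2 * m))) := by
        rw [Finset.sum_const, nsmul_eq_mul, Set.ncard_eq_toFinset_card _ hfin]
    _ ≤ _ := mul_le_mul_of_nonneg_right (hB u) (by positivity)

variable [MeasurableSpace Ω]

theorem measurable_hits {m : ℕ} {A : Set Ω} (hA : MeasurableSet A) :
    Measurable (hits A : (Fin m → Ω) → ℝ) := by
  unfold hits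
  refine Finset.measurable_sum _ fun i _ => ?_
  exact (measurable_one.indicator hA).comp (measurable_pi_apply i)

/-- Hoeffding's inequality bounds the complementary event by `exp (-T ^ 2 / (2 * m)) ≤ exp (-1) ≤ 1
/ 2`. It serves the ghost sample in the symmetrization. -/
theorem half_le_measure_hits_le (P : Measure Ω) [IsProbabilityMeasure P] {m : ℕ} (hm : 0 < m)
    {A : Set Ω} (hA : MeasurableSet A) {T : ℝ} (hT : 0 ≤ T) (hT2 : 2 * m ≤ T ^ 2) :
    (1 / 2 : ℝ≥0∞) ≤ Measure.pi (fun _ : Fin m => P) {z | hits A z < m * P.real A + T / 2} := by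
  set μ := Measure.pi (fun _ : Fin m => P)
  have hm' : (0 : ℝ) < m := by exact_mod_cast hm
  have hint : ∫ x, A.indicator (1 : Ω → ℝ) x ∂P = P.real A := by
    rw [integral_indicator_one hA]
  have hsub : HasSubgaussianMGF
      (fun x => A.indicator (1 : Ω → ℝ) x - P.real A) ((‖(1 : ℝ) - 0‖₊ / 2) ^ 2) P := by
    rw [← hint]
    refine hasSubgaussianMGF_of_mem_Icc (measurable_one.indicator hA).aemeasurable ?_
    refine Filter.Eventually.of_forall fun x => ?_
    by_cases hx : x ∈ A <;> simp [hx]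
  have hind : iIndepFun (fun (i : Fin m) (z : Fin m → Ω) => A.indicator (1 : Ω → ℝ) (z i) - P.real A)
      μ := by
    refine iIndepFun_pi (X := fun _ x => A.indicator (1 : Ω → ℝ) x - P.real A) fun i => ?_
    exact ((measurable_one.indicator hA).sub_const _).aemeasurable
  have hsub' : ∀ i ∈ (Finset.univ : Finset (Fin m)), HasSubgaussianMGF
      (fun z : Fin m → Ω => A.indicator (1 : Ω → ℝ) (z i) - P.real A)
        ((‖(1 : ℝ) - 0‖₊ / 2) ^ 2) μ := by
    intro i _
    refine HasSubgaussianMGF.of_map (Y := fun z : Fin m → Ω => z i)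
      (X := fun x => A.indicator (1 : Ω → ℝ) x - P.real A)
      (measurable_pi_apply i).aemeasurable ?_
    rw [(measurePreserving_eval (fun _ : Fin m => P) i).map_eq]
    exact hsub
  have key := HasSubgaussianMGF.measure_sum_ge_le_of_iIndepFun hind hsub' (ε := T / 2)
    (by positivity)
  have hset : {z : Fin m → Ω | hits A z < m * P.real A + T / 2}
      = {z | T / 2 ≤ ∑ i, (A.indicator (1 : Ω → ℝ) (z i) - P.real A)}ᶜ := by
    ext z
    simp only [hits, Set.mem_ofPred_eq, Set.mem_compl_iff, not_le, Finset.sum_sub_distrib,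
      Finset.sum_const, Finset.card_univ, Fintype.card_fin, nsmul_eq_mul]
    constructor <;> intro h <;> linarith
  have hmeas : MeasurableSet {z : Fin m → Ω |
      T / 2 ≤ ∑ i, (A.indicator (1 : Ω → ℝ) (z i) - P.real A)} := by
    refine measurableSet_le measurable_const (Finset.measurable_sum _ fun i _ => ?_)
    exact ((measurable_one.indicator hA).comp (measurable_pi_apply i)).sub_const _
  have hle : μ.real {z : Fin m → Ω | T / 2 ≤ ∑ i, (A.indicator (1 : Ω → ℝ) (z i) - P.real A)}
      ≤ 1 / 2 := by
    refine key.trans ?_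
    have h1 : Real.exp (-(T / 2) ^ 2 / (2 * ((∑ _i : Fin m, (‖(1 : ℝ) - 0‖₊ / 2) ^ 2 : NNReal) : ℝ)))
        ≤ Real.exp (-1) := by
      rw [Real.exp_le_exp]
      simp only [sub_zero, nnnorm_one, Finset.sum_const, Finset.card_univ, Fintype.card_fin,
        nsmul_eq_mul]
      push_cast
      rw [div_le_iff₀ (by positivity)]
      nlinarith
    refine h1.trans ?_
    rw [Real.exp_neg, one_div]
    refine inv_anti₀ (by norm_num) ?_
    linarith [Real.add_one_le_exp (1 : ℝ)]
  have hle' : μ {z : Fin m → Ω | T / 2 ≤ ∑ i, (A.indicator (1 : Ω → ℝ) (z i) - P.real A)}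
      ≤ 1 / 2 := by
    have := (ENNReal.le_ofReal_iff_toReal_le (measure_ne_top μ _) (by norm_num)).2 hle
    refine this.trans (le_of_eq ?_)
    rw [ENNReal.ofReal_div_of_pos (by norm_num)]
    simp
  rw [hset, prob_compl_eq_one_sub hmeas]
  calc (1 / 2 : ℝ≥0∞) = 1 - 1 / 2 := by
        rw [one_div, ENNReal.one_sub_inv_two]
    _ ≤ _ := tsub_le_tsub_left hle' _

variable [Countable ι]

theorem measurableSet_exists_difference {m : ℕ} {A : ι → Set Ω} (hA : ∀ j, MeasurableSet (A j))
    (t : ℝ) :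
    MeasurableSet {w : Fin m → Ω × Ω | ∃ j, t < ∑ i,
      ((A j).indicator (1 : Ω → ℝ) (w i).1 - (A j).indicator 1 (w i).2)} := by
  have : {w : Fin m → Ω × Ω | ∃ j, t < ∑ i,
      ((A j).indicator (1 : Ω → ℝ) (w i).1 - (A j).indicator 1 (w i).2)}
      = ⋃ j, {w | t < ∑ i,
      ((A j).indicator (1 : Ω → ℝ) (w i).1 - (A j).indicator 1 (w i).2)} := by
    ext; simp
  rw [this]
  refine MeasurableSet.iUnion fun j => measurableSet_lt measurable_const ?_
  refine Finset.measurable_sum _ fun i _ => ?_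
  exact ((measurable_one.indicator (hA j)).comp (measurable_pi_apply i).fst).sub
    ((measurable_one.indicator (hA j)).comp (measurable_pi_apply i).snd)

/-- Exchanging the two points of any pair preserves the product measure, so the probability is the
mean proportion of bad exchanges. For each fixed double sample that proportion is controlled by
`card_swaps_le`. -/
theorem measure_exists_difference_le (P : Measure Ω) [IsProbabilityMeasure P] {m : ℕ} (hm : 0 < m)
    {A : ι → Set Ω} (hA : ∀ j, MeasurableSet (A j)) {B : ℝ}
    (hB : ∀ u : Fin m ⊕ Fin m → Ω, ((traces A u).ncard : ℝ) ≤ B) {t : ℝ} (ht : 0 ≤ t) :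
    Measure.pi (fun _ : Fin m => P.prod P) {w | ∃ j, t < ∑ i,
      ((A j).indicator (1 : Ω → ℝ) (w i).1 - (A j).indicator 1 (w i).2)}
      ≤ ENNReal.ofReal (B * Real.exp (-t ^ 2 / (2 * m))) := by
  classical
  set D := {w : Fin m → Ω × Ω | ∃ j, t < ∑ i,
      ((A j).indicator (1 : Ω → ℝ) (w i).1 - (A j).indicator 1 (w i).2)} with hD
  have hDm : MeasurableSet D := measurableSet_exists_difference hA t
  set μ := Measure.pi (fun _ : Fin m => P.prod P)
  let sw : (Fin m → Bool) → (Fin m → Ω × Ω) → (Fin m → Ω × Ω) :=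
    fun σ w i => if σ i then (w i).swap else w i
  have hsw : ∀ σ, MeasurePreserving (sw σ) μ μ := by
    intro σ
    refine measurePreserving_pi (fun _ => P.prod P) (fun _ => P.prod P)
      (f := fun i x => if σ i then x.swap else x) fun i => ?_
    cases σ i
    · exact MeasurePreserving.id _
    · exact Measure.measurePreserving_swap
  have hiff : ∀ σ w, sw σ w ∈ D ↔ ∃ j, t < ∑ i, boolSign (σ i) *
      ((A j).indicator (1 : Ω → ℝ) (w i).1 - (A j).indicator 1 (w i).2) := by
    intro σ w
    simp only [hD, Set.mem_ofPred_eq]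
    refine exists_congr fun j => ?_
    rw [Finset.sum_congr rfl fun i _ => ?_]
    by_cases h : σ i <;> simp [sw, h, boolSign]
  have hsum : (2 ^ m : ℝ≥0∞) * μ D
      = ∫⁻ w, ((Finset.univ.filter fun σ : Fin m → Bool => sw σ w ∈ D).card : ℝ≥0∞) ∂μ := by
    have h1 : ∀ w, ((Finset.univ.filter fun σ : Fin m → Bool => sw σ w ∈ D).card : ℝ≥0∞)
        = ∑ σ : Fin m → Bool, (sw σ ⁻¹' D).indicator 1 w := by
      intro w
      rw [Finset.card_eq_sum_ones, Nat.cast_sum, Finset.sum_filter]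
      refine Finset.sum_congr rfl fun σ _ => ?_
      simp [Set.indicator_apply]
    simp_rw [h1]
    rw [lintegral_finsetSum _ fun σ _ => measurable_one.indicator ((hsw σ).measurable hDm)]
    simp_rw [lintegral_indicator_one ((hsw _).measurable hDm),
      (hsw _).measure_preimage hDm.nullMeasurableSet]
    simp
  have hle : (2 ^ m : ℝ≥0∞) * μ D
      ≤ ENNReal.ofReal (B * (2 ^ m * Real.exp (-t ^ 2 / (2 * m)))) := by
    rw [hsum]
    calc _ ≤ ∫⁻ _w, ENNReal.ofReal (B * (2 ^ m * Real.exp (-t ^ 2 / (2 * m)))) ∂μ := by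
          refine lintegral_mono fun w => ?_
          rw [← ENNReal.ofReal_natCast]
          refine ENNReal.ofReal_le_ofReal ?_
          refine le_trans (le_of_eq ?_) (card_swaps_le hm A hB ht w)
          congr 2
          ext σ
          simp [hiff]
      _ = _ := by simp
  have h2 : (2 ^ m : ℝ≥0∞) = ENNReal.ofReal (2 ^ m) := by
    rw [ENNReal.ofReal_pow (by norm_num)]; simp
  have h3 : B * (2 ^ m * Real.exp (-t ^ 2 / (2 * m)))
      = 2 ^ m * (B * Real.exp (-t ^ 2 / (2 * m))) := by ring
  rw [h3, ENNReal.ofReal_mul (by positivity), ← h2] at hle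
  exact (ENNReal.mul_le_mul_iff_right (by positivity) (by simp)).1 hle

/-- One-sided Vapnik-Chervonenkis inequality. -/
theorem measure_exists_hits_gt_le (P : Measure Ω) [IsProbabilityMeasure P] {m : ℕ} (hm : 0 < m)
    {A : ι → Set Ω} (hA : ∀ j, MeasurableSet (A j)) {B : ℝ}
    (hB : ∀ u : Fin m ⊕ Fin m → Ω, ((traces A u).ncard : ℝ) ≤ B) {T : ℝ} (hT : 0 ≤ T)
    (hT2 : 2 * m ≤ T ^ 2) :
    Measure.pi (fun _ : Fin m => P) {z | ∃ j, m * P.real (A j) + T < hits (A j) z}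
      ≤ ENNReal.ofReal (2 * (B * Real.exp (-T ^ 2 / (8 * m)))) := by
  set μ := Measure.pi (fun _ : Fin m => P) with hμ
  set D := {w : Fin m → Ω × Ω | ∃ j, T / 2 < ∑ i,
      ((A j).indicator (1 : Ω → ℝ) (w i).1 - (A j).indicator 1 (w i).2)} with hD
  have hDm : MeasurableSet D := measurableSet_exists_difference hA _
  have hDle : Measure.pi (fun _ : Fin m => P.prod P) D
      ≤ ENNReal.ofReal (B * Real.exp (-T ^ 2 / (8 * m))) := by
    have := measure_exists_difference_le P hm hA hB (t := T / 2) (by positivity)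
    convert this using 4
    ring
  set D' : Set ((Fin m → Ω) × (Fin m → Ω)) :=
    {p | ∃ j, T / 2 < hits (A j) p.1 - hits (A j) p.2} with hD'
  have hD'm : MeasurableSet D' := by
    have : D' = ⋃ j, {p | T / 2 < hits (A j) p.1 - hits (A j) p.2} := by
      ext; simp [hD']
    rw [this]
    exact MeasurableSet.iUnion fun j => measurableSet_lt measurable_const
      (((measurable_hits (hA j)).comp measurable_fst).sub
        ((measurable_hits (hA j)).comp measurable_snd))
  have hDD' : Measure.pi (fun _ : Fin m => P.prod P) D = (μ.prod μ) D' := by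
    have mp := measurePreserving_arrowProdEquivProdArrow Ω Ω (Fin m) (fun _ => P) (fun _ => P)
    rw [← mp.measure_preimage hD'm.nullMeasurableSet]
    congr 1
    ext w
    simp [hD, hD', hits, MeasurableEquiv.arrowProdEquivProdArrow, Equiv.arrowProdEquivProdArrow]
  set G : Set (Fin m → Ω) := {z | ∃ j, m * P.real (A j) + T < hits (A j) z} with hG
  have hGm : MeasurableSet G := by
    have : G = ⋃ j, {z | m * P.real (A j) + T < hits (A j) z} := by
      ext; simp [hG]
    rw [this]
    exact MeasurableSet.iUnion fun j => measurableSet_lt measurable_const (measurable_hits (hA j))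
  -- If the first sample exceeds its mean by `T`, an independent second one stays below mean plus `T
  -- / 2` with probability at least one half, which leaves a gap above `T / 2`.
  have hhalf : (1 / 2 : ℝ≥0∞) * μ G ≤ (μ.prod μ) D' := by
    rw [Measure.prod_apply hD'm, ← lintegral_indicator_const hGm]
    refine lintegral_mono fun z => ?_
    by_cases hz : z ∈ G
    · rw [Set.indicator_of_mem hz]
      obtain ⟨j, hj⟩ := hz
      refine (half_le_measure_hits_le P hm (hA j) hT hT2).trans (measure_mono fun z' hz' => ?_)
      refine ⟨j, ?_⟩
      simp only [Set.mem_ofPred_eq] at hz' ⊢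
      linarith
    · rw [Set.indicator_of_notMem hz]
      exact zero_le
  rw [ENNReal.ofReal_mul (by norm_num)]
  calc μ G = 2 * ((1 / 2 : ℝ≥0∞) * μ G) := by
        rw [← mul_assoc, one_div, ENNReal.mul_inv_cancel (by simp) (by simp), one_mul]
    _ ≤ 2 * ENNReal.ofReal (B * Real.exp (-T ^ 2 / (8 * m))) := by
        gcongr
        exact hhalf.trans (hDD' ▸ hDle)
    _ = _ := by simp

end UniformDeviation

/-! ### Growth function and uniform deviation of linear classifiers -/

namespace ClusterLearning

open Filter Topology

/-- The set of labeled points that are misclassified by `h`. -/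
def errorSet {E : Type*} (h : E → Fin 2) : Set (E × Fin 2) := {z | h z.1 ≠ z.2}

theorem zeroOneLoss_eq_indicator {E : Type*} (h : E → Fin 2) (z : E × Fin 2) :
    zeroOneLoss (h z.1) z.2 = (errorSet h).indicator 1 z := by
  by_cases hz : h z.1 = z.2 <;> simp [zeroOneLoss, errorSet, hz]

theorem empRisk_eq_hits_div {E : Type*} {m : ℕ} (S : Fin m → E × Fin 2) (h : E → Fin 2) :
    empRisk S h = hits (errorSet h) S / m := by
  simp [empRisk, hits, zeroOneLoss_eq_indicator]

theorem measurableSet_errorSet {E : Type*} [MeasurableSpace E] {h : E → Fin 2}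
    (hh : Measurable h) : MeasurableSet (errorSet h) :=
  (measurableSet_eq_fun (hh.comp measurable_fst) measurable_snd).compl

theorem risk_eq_measureReal {E : Type*} [MeasurableSpace E] (P : Measure (E × Fin 2))
    {h : E → Fin 2} (hh : Measurable h) : risk P h = P.real (errorSet h) := by
  simp only [risk, zeroOneLoss_eq_indicator]
  exact integral_indicator_one (measurableSet_errorSet hh)

/-- The classifier `x ↦ 1[⟨w, x⟩ + b ≥ 0]`. -/
noncomputable def halfspaceClassifier {ι : Type*} [Fintype ι] (p : EuclideanSpace ℝ ι × ℝ) :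
    EuclideanSpace ℝ ι → Fin 2 :=
  fun x => if 0 ≤ inner ℝ p.1 x + p.2 then 1 else 0

theorem mem_linearClassifiers_iff {ι : Type*} [Fintype ι] {h : EuclideanSpace ℝ ι → Fin 2} :
    h ∈ linearClassifiers ι ↔ ∃ p, h = halfspaceClassifier p := by
  constructor
  · rintro ⟨w, b, hwb⟩
    exact ⟨(w, b), funext hwb⟩
  · rintro ⟨p, rfl⟩
    exact ⟨p.1, p.2, fun _ => rfl⟩

theorem measurable_halfspaceClassifier {ι : Type*} [Fintype ι] (p : EuclideanSpace ℝ ι × ℝ) :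
    Measurable (halfspaceClassifier p) := by
  refine Measurable.ite ?_ measurable_const measurable_const
  exact measurableSet_le measurable_const (by fun_prop)

theorem measurable_of_mem_linearClassifiers {ι : Type*} [Fintype ι]
    {h : EuclideanSpace ℝ ι → Fin 2} (hh : h ∈ linearClassifiers ι) : Measurable h := by
  obtain ⟨p, rfl⟩ := mem_linearClassifiers_iff.1 hh
  exact measurable_halfspaceClassifier p

open Classical in
/-- A set of points shattered by the closed half-spaces of `ℝ^n` has at most `n + 1` elements. -/
theorem card_le_of_shatters {n : ℕ} {κ : Type*} [Fintype κ] (x : κ → EuclideanSpace ℝ (Fin n))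
    {𝒜 : Finset (Finset κ)}
    (h𝒜 : ∀ V ∈ 𝒜, ∃ p, ∀ k, k ∈ V ↔ halfspaceClassifier p (x k) = 1)
    {t : Finset κ} (ht : 𝒜.Shatters t) : t.card ≤ n + 1 := by
  by_contra hcard
  have hdep : ¬ AffineIndependent ℝ (fun k : t => x k) := by
    intro hind
    have h1 := hind.card_le_finrank_succ
    have h2 := Submodule.finrank_le (vectorSpan ℝ (Set.range fun k : t => x k))
    rw [finrank_euclideanSpace_fin] at h2
    rw [Fintype.card_coe] at h1
    omega
  obtain ⟨I, q, hq1, hq2⟩ := Convex.radon_partition hdep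
  -- Shattering cuts out one half of the Radon partition by a closed half-space; the common point
  -- `q` of the two hulls would lie both in it and in its complement.
  obtain ⟨V, hV, hVt⟩ := ht (t := t.filter fun k => ∃ hk : k ∈ t, (⟨k, hk⟩ : t) ∈ I)
    (Finset.filter_subset _ _)
  obtain ⟨p, hp⟩ := h𝒜 V hV
  have hmem : ∀ k : t, k ∈ I ↔ 0 ≤ inner ℝ p.1 (x k) + p.2 := by
    intro k
    have h1 : (k : κ) ∈ V ↔ k ∈ I := by
      have := Finset.ext_iff.1 hVt k
      simpa using this
    rw [← h1, hp]
    by_cases h : 0 ≤ inner ℝ p.1 (x k) + p.2 <;> simp [halfspaceClassifier, h]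
  have hlin : IsLinearMap ℝ fun y : EuclideanSpace ℝ (Fin n) => inner ℝ p.1 y :=
    (innerₗ (EuclideanSpace ℝ (Fin n)) p.1).isLinear
  have h1 : q ∈ {y : EuclideanSpace ℝ (Fin n) | -p.2 ≤ inner ℝ p.1 y} := by
    refine convexHull_min ?_ (convex_halfSpace_ge hlin _) hq1
    rintro _ ⟨k, hk, rfl⟩
    have := (hmem k).1 hk
    simp only [Set.mem_ofPred_eq]
    linarith
  have h2 : q ∈ {y : EuclideanSpace ℝ (Fin n) | inner ℝ p.1 y < -p.2} := by
    refine convexHull_min ?_ (convex_halfSpace_lt hlin _) hq2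
    rintro _ ⟨k, hk, rfl⟩
    have := mt (hmem k).2 hk
    simp only [Set.mem_ofPred_eq]
    linarith
  simp only [Set.mem_ofPred_eq] at h1 h2
  exact absurd h2 (not_lt.2 h1)

/-- An error set has as trace the symmetric difference of a half-space trace with the fixed set of
points labeled `1`, so labels create no new traces. The Sauer-Shelah lemma counts the half-space
traces. -/
theorem ncard_traces_errorSet_le {n : ℕ} {κ : Type*} [Fintype κ] {ι : Type*}
    (g : ι → EuclideanSpace ℝ (Fin n) × ℝ) (u : κ → EuclideanSpace ℝ (Fin n) × Fin 2) :
    (traces (fun j => errorSet (halfspaceClassifier (g j))) u).ncard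
      ≤ ∑ k ∈ Finset.Iic (n + 1), (Fintype.card κ).choose k := by
  classical
  let 𝒜 : Finset (Finset κ) := Finset.univ.filter fun V =>
    ∃ p, ∀ k, k ∈ V ↔ halfspaceClassifier p (u k).1 = 1
  have hvc : 𝒜.vcDim ≤ n + 1 := by
    refine Finset.sup_le fun t ht => ?_
    exact card_le_of_shatters (fun k => (u k).1) (fun V hV => (Finset.mem_filter.1 hV).2)
      (Finset.mem_shatterer.1 ht)
  have hcard : 𝒜.card ≤ ∑ k ∈ Finset.Iic (n + 1), (Fintype.card κ).choose k :=
    (Finset.card_le_card_shatterer 𝒜).trans <| Finset.card_shatterer_le_sum_vcDim.trans <|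
      Finset.sum_le_sum_of_subset (Finset.Iic_subset_Iic.2 hvc)
  have hsub : traces (fun j => errorSet (halfspaceClassifier (g j))) u
      ⊆ (fun V : Finset κ => symmDiff (V : Set κ) {k | (u k).2 = 1}) '' (𝒜 : Set (Finset κ)) := by
    rintro _ ⟨j, rfl⟩
    refine ⟨Finset.univ.filter fun k => halfspaceClassifier (g j) (u k).1 = 1, ?_, ?_⟩
    · simp only [𝒜, Finset.coe_filter, Finset.mem_univ, true_and, Set.mem_ofPred_eq,
        Finset.mem_filter]
      exact ⟨g j, fun k => Iff.rfl⟩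
    · ext k
      simp only [Set.mem_symmDiff, Finset.coe_filter, Finset.mem_univ, true_and,
        Set.mem_ofPred_eq, errorSet]
      generalize halfspaceClassifier (g j) (u k).1 = a
      generalize (u k).2 = b
      revert a b
      decide
  calc _ ≤ ((fun V : Finset κ => symmDiff (V : Set κ) {k | (u k).2 = 1}) ''
        (𝒜 : Set (Finset κ))).ncard := Set.ncard_le_ncard hsub (Set.toFinite _)
    _ ≤ (𝒜 : Set (Finset κ)).ncard := Set.ncard_image_le (Set.toFinite _)
    _ = 𝒜.card := Set.ncard_coe_finset _
    _ ≤ _ := hcard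

/-- With `r = d / M ≤ 1`, each term is weighted by `r ^ d ≤ r ^ k`; the binomial theorem gives at
most `(1 + r) ^ M ≤ exp (r * M) = exp d`. -/
theorem sum_choose_le_pow {M d : ℕ} (hd : 0 < d) (hdM : d ≤ M) :
    ((∑ k ∈ Finset.Iic d, M.choose k : ℕ) : ℝ) ≤ (Real.exp 1 * M / d) ^ d := by
  have hd' : (0 : ℝ) < d := by exact_mod_cast hd
  have hM' : (0 : ℝ) < M := by exact_mod_cast hd.trans_le hdM
  set r : ℝ := d / M with hr
  have hr0 : 0 < r := by positivity
  have hr1 : r ≤ 1 := by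
    rw [hr, div_le_one hM']
    exact_mod_cast hdM
  have h1 : r ^ d * ((∑ k ∈ Finset.Iic d, M.choose k : ℕ) : ℝ) ≤ Real.exp 1 ^ d := by
    calc r ^ d * ((∑ k ∈ Finset.Iic d, M.choose k : ℕ) : ℝ)
        = ∑ k ∈ Finset.Iic d, r ^ d * (M.choose k : ℝ) := by
          rw [Nat.cast_sum, Finset.mul_sum]
      _ ≤ ∑ k ∈ Finset.Iic d, r ^ k * 1 ^ (M - k) * (M.choose k : ℝ) := by
          refine Finset.sum_le_sum fun k hk => ?_
          rw [one_pow, mul_one]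
          exact mul_le_mul_of_nonneg_right
            (pow_le_pow_of_le_one hr0.le hr1 (Finset.mem_Iic.1 hk)) (by positivity)
      _ ≤ ∑ k ∈ Finset.range (M + 1), r ^ k * 1 ^ (M - k) * (M.choose k : ℝ) := by
          refine Finset.sum_le_sum_of_subset_of_nonneg ?_ fun k _ _ => by positivity
          intro k hk
          have := Finset.mem_Iic.1 hk
          exact Finset.mem_range.2 (by omega)
      _ = (r + 1) ^ M := (add_pow r 1 M).symm
      _ ≤ Real.exp r ^ M := pow_le_pow_left₀ (by positivity) (Real.add_one_le_exp r) M
      _ = Real.exp 1 ^ d := by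
          rw [← Real.exp_nat_mul, ← Real.exp_nat_mul, hr]
          congr 1
          field_simp
  have h2 : (Real.exp 1 * M / d) ^ d = Real.exp 1 ^ d / r ^ d := by
    rw [← div_pow, hr]
    congr 1
    field_simp
  rw [h2, le_div_iff₀ (by positivity), mul_comm]
  exact h1

/-- Every half-space classifier is a pointwise limit of classifiers from a dense set. -/
theorem exists_seq_halfspaceClassifier {n : ℕ} {D : Set (EuclideanSpace ℝ (Fin n) × ℝ)}
    (hD : Dense D) (p : EuclideanSpace ℝ (Fin n) × ℝ) :
    ∃ q : ℕ → EuclideanSpace ℝ (Fin n) × ℝ, (∀ k, q k ∈ D) ∧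
      ∀ x, ∀ᶠ k in atTop, halfspaceClassifier (q k) x = halfspaceClassifier p x := by
  -- The offset is pushed up by order `1 / k`, which outweighs the `‖x‖ / k ^ 2` error of the normal
  -- vector. Thus boundary points stay in the closed half-space, while strictly negative values
  -- remain negative in the limit.
  have hex : ∀ k : ℕ, ∃ q ∈ D, dist q.1 p.1 < 1 / ((k : ℝ) + 1) ^ 2 ∧
      q.2 ∈ Set.Ioo (p.2 + 1 / ((k : ℝ) + 1)) (p.2 + 2 / ((k : ℝ) + 1)) := by
    intro k
    have hk : (0 : ℝ) < (k : ℝ) + 1 := by positivity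
    obtain ⟨q, hq, hqD⟩ := hD.inter_open_nonempty
      (Metric.ball p.1 (1 / ((k : ℝ) + 1) ^ 2) ×ˢ
        Set.Ioo (p.2 + 1 / ((k : ℝ) + 1)) (p.2 + 2 / ((k : ℝ) + 1)))
      (Metric.isOpen_ball.prod isOpen_Ioo)
      ((Metric.nonempty_ball.2 (by positivity)).prod
        (Set.nonempty_Ioo.2 (by gcongr; norm_num)))
    exact ⟨q, hqD, hq.1, hq.2⟩
  choose q hqD hq1 hq2 using hex
  refine ⟨q, hqD, fun x => ?_⟩
  have hinner : ∀ k, |inner ℝ (q k).1 x - inner ℝ p.1 x| ≤ 1 / ((k : ℝ) + 1) ^ 2 * ‖x‖ := by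
    intro k
    rw [← inner_sub_left]
    refine (abs_real_inner_le_norm _ _).trans ?_
    rw [← dist_eq_norm]
    exact mul_le_mul_of_nonneg_right (hq1 k).le (norm_nonneg _)
  by_cases h0 : 0 ≤ inner ℝ p.1 x + p.2
  · obtain ⟨K, hK⟩ := exists_nat_ge ‖x‖
    filter_upwards [eventually_ge_atTop K] with k hk
    have hk' : (K : ℝ) ≤ k := by exact_mod_cast hk
    have hkp : (0 : ℝ) < (k : ℝ) + 1 := by positivity
    have h1 : 1 / ((k : ℝ) + 1) ^ 2 * ‖x‖ ≤ 1 / ((k : ℝ) + 1) := by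
      rw [div_mul_eq_mul_div, one_mul, div_le_div_iff₀ (by positivity) hkp]
      nlinarith
    have h2 := (abs_le.1 (hinner k)).1
    have h3 := (hq2 k).1
    have h4 : 0 ≤ inner ℝ (q k).1 x + (q k).2 := by linarith
    simp [halfspaceClassifier, h0, h4]
  · have hlim : Tendsto (fun k : ℕ => 1 / ((k : ℝ) + 1) * ‖x‖ + 2 * (1 / ((k : ℝ) + 1))) atTop
        (𝓝 (0 * ‖x‖ + 2 * 0)) :=
      (tendsto_one_div_add_atTop_nhds_zero_nat.mul_const _).add
        (tendsto_one_div_add_atTop_nhds_zero_nat.const_mul _)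
    have hlt : (0 : ℝ) * ‖x‖ + 2 * 0 < -(inner ℝ p.1 x + p.2) := by
      push Not at h0
      linarith
    filter_upwards [hlim.eventually_lt_const hlt] with k hk
    have hkp : (1 : ℝ) ≤ (k : ℝ) + 1 := by linarith [(Nat.cast_nonneg k : (0 : ℝ) ≤ k)]
    have h1 : 1 / ((k : ℝ) + 1) ^ 2 * ‖x‖ ≤ 1 / ((k : ℝ) + 1) * ‖x‖ := by
      refine mul_le_mul_of_nonneg_right ?_ (norm_nonneg _)
      exact one_div_le_one_div_of_le (by linarith) (by nlinarith)
    have h2 := (abs_le.1 (hinner k)).2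
    have h3 := (hq2 k).2
    have h5 : 2 / ((k : ℝ) + 1) = 2 * (1 / ((k : ℝ) + 1)) := by ring
    have h4 : ¬ 0 ≤ inner ℝ (q k).1 x + (q k).2 := by
      push Not
      linarith
    simp [halfspaceClassifier, h0, h4]

/-- Replaces all half-spaces by countably many. Along the approximating sequence the risk converges
by dominated convergence and the empirical risk is eventually constant, so the strict inequality
survives. -/
theorem exists_dense_empRisk_gt {n m : ℕ} (P : Measure (EuclideanSpace ℝ (Fin n) × Fin 2))
    [IsProbabilityMeasure P] {D : Set (EuclideanSpace ℝ (Fin n) × ℝ)} (hD : Dense D)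
    (S : Fin m → EuclideanSpace ℝ (Fin n) × Fin 2) {ε : ℝ} {p : EuclideanSpace ℝ (Fin n) × ℝ}
    (hp : risk P (halfspaceClassifier p) + ε < empRisk S (halfspaceClassifier p)) :
    ∃ q ∈ D, risk P (halfspaceClassifier q) + ε < empRisk S (halfspaceClassifier q) := by
  obtain ⟨q, hqD, hq⟩ := exists_seq_halfspaceClassifier hD p
  have hrisk : Tendsto (fun k => risk P (halfspaceClassifier (q k))) atTop
      (𝓝 (risk P (halfspaceClassifier p))) := by
    refine tendsto_integral_of_dominated_convergence (fun _ => 1) (fun k => ?_)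
      (integrable_const _) (fun k => ?_) ?_
    · simp only [zeroOneLoss_eq_indicator]
      exact (measurable_one.indicator
        (measurableSet_errorSet (measurable_halfspaceClassifier _))).aestronglyMeasurable
    · refine Eventually.of_forall fun z => ?_
      unfold zeroOneLoss
      split_ifs <;> simp
    · refine Eventually.of_forall fun z => ?_
      refine tendsto_const_nhds.congr' ?_
      filter_upwards [hq z.1] with k hk
      rw [hk]
  have hemp : ∀ᶠ k in atTop, empRisk S (halfspaceClassifier (q k))
      = empRisk S (halfspaceClassifier p) := by
    filter_upwards [eventually_all.2 fun i => hq (S i).1] with k hk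
    simp only [empRisk, hk]
  have hlt : ∀ᶠ k in atTop, risk P (halfspaceClassifier (q k))
      < empRisk S (halfspaceClassifier p) - ε := hrisk.eventually_lt_const (by linarith)
  obtain ⟨k, hk1, hk2⟩ := (hemp.and hlt).exists
  exact ⟨q k, hqD k, by linarith⟩

/-- The width of the confidence interval for linear classifiers. -/
noncomputable def vcWidth (n m : ℕ) (δ : ℝ) : ℝ :=
  √((8 * (n + 1) * Real.log (2 * Real.exp 1 * m / (n + 1)) + 8 * Real.log (12 / δ)) / m)

/-- With `T = m * vcWidth n m δ` one has `T ^ 2 / (8 * m) = (n + 1) * log (2em / (n + 1)) + log (12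
/ δ)`. The exponential cancels the growth bound `B` and leaves `2 * (δ / 12)`. The condition `n + 1
≤ 2 * m` is the range of the binomial estimate for `2m` points. -/
theorem measure_exists_linear_deviation_le {n m : ℕ}
    (P : Measure (EuclideanSpace ℝ (Fin n) × Fin 2)) [IsProbabilityMeasure P]
    (hm : 0 < m) (hnm : n + 1 ≤ 2 * m) {δ : ℝ} (hδ : 0 < δ) (hδ1 : δ < 1) :
    Measure.pi (fun _ : Fin m => P)
      {S | ∃ h ∈ linearClassifiers (Fin n), risk P h + vcWidth n m δ < empRisk S h}
      ≤ ENNReal.ofReal (δ / 6) := by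
  have hm' : (0 : ℝ) < m := by exact_mod_cast hm
  have hn' : (0 : ℝ) < (n : ℝ) + 1 := by positivity
  obtain ⟨D, hDc, hD⟩ := TopologicalSpace.exists_countable_dense (EuclideanSpace ℝ (Fin n) × ℝ)
  have : Countable D := hDc.to_subtype
  set R : ℝ := 8 * (n + 1) * Real.log (2 * Real.exp 1 * m / (n + 1)) + 8 * Real.log (12 / δ)
  have hlog1 : 0 ≤ Real.log (2 * Real.exp 1 * m / (n + 1)) := by
    refine Real.log_nonneg ?_
    rw [le_div_iff₀ hn', one_mul]
    have h1 : ((n : ℝ) + 1) ≤ 2 * m := by exact_mod_cast hnm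
    have h2 : (1 : ℝ) ≤ Real.exp 1 := Real.one_le_exp (by norm_num)
    nlinarith
  have hlog2 : 1 ≤ Real.log (12 / δ) := by
    rw [Real.le_log_iff_exp_le (by positivity)]
    have h1 := Real.exp_one_lt_d9
    have h2 : (12 : ℝ) ≤ 12 / δ := by
      rw [le_div_iff₀ hδ]
      linarith
    linarith
  have hR : 8 ≤ R := by
    have : 0 ≤ 8 * ((n : ℝ) + 1) * Real.log (2 * Real.exp 1 * m / (n + 1)) := by positivity
    linarith
  have hT : (m * vcWidth n m δ) ^ 2 = m * R := by
    rw [mul_pow, vcWidth, Real.sq_sqrt (div_nonneg (by linarith) hm'.le), sq, mul_assoc,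
      mul_div_cancel₀ _ hm'.ne']
  set B : ℝ := (2 * Real.exp 1 * m / (n + 1)) ^ (n + 1)
  have hB : ∀ u : Fin m ⊕ Fin m → EuclideanSpace ℝ (Fin n) × Fin 2,
      ((traces (fun j : D => errorSet (halfspaceClassifier j.1)) u).ncard : ℝ) ≤ B := by
    intro u
    refine (Nat.cast_le.2 (ncard_traces_errorSet_le (fun j : D => j.1) u)).trans ?_
    refine (sum_choose_le_pow (by omega) ?_).trans (le_of_eq ?_)
    · simp only [Fintype.card_sum, Fintype.card_fin]
      omega
    · simp only [Fintype.card_sum, Fintype.card_fin, B]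
      push_cast
      congr 2
      ring
  have key := measure_exists_hits_gt_le P hm
    (A := fun j : D => errorSet (halfspaceClassifier j.1))
    (fun j => measurableSet_errorSet (measurable_halfspaceClassifier _)) hB
    (T := m * vcWidth n m δ) (mul_nonneg hm'.le (Real.sqrt_nonneg _)) (by rw [hT]; nlinarith)
  refine (measure_mono ?_).trans (key.trans (ENNReal.ofReal_le_ofReal (le_of_eq ?_)))
  · rintro S ⟨h, hh, hS⟩
    obtain ⟨p, rfl⟩ := mem_linearClassifiers_iff.1 hh
    obtain ⟨q, hq, hqS⟩ := exists_dense_empRisk_gt P hD S hS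
    refine ⟨⟨q, hq⟩, ?_⟩
    rw [risk_eq_measureReal P (measurable_halfspaceClassifier q), empRisk_eq_hits_div,
      lt_div_iff₀ hm'] at hqS
    simp only
    linarith
  · rw [hT]
    have h1 : -(m * R) / (8 * m) = -(((n + 1 : ℕ) : ℝ) *
        Real.log (2 * Real.exp 1 * m / (n + 1))) + -Real.log (12 / δ) := by
      simp only [R]
      push_cast
      field_simp
      ring
    rw [h1, Real.exp_add, Real.exp_neg, Real.exp_neg, Real.exp_nat_mul,
      Real.exp_log (by positivity), Real.exp_log (by positivity)]
    have hB0 : 0 < B := by positivity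
    change 2 * (B * (B⁻¹ * (12 / δ)⁻¹)) = δ / 6
    field_simp
    norm_num

end ClusterLearning

/-! ### Mass not seen by a sample -/

namespace ClusterLearning

theorem le_alphaBound {k ml : ℕ} {δ : ℝ} (hδ : 0 < δ) {t : ℝ} (ht : t ∈ Set.Ico (0 : ℝ) 1) :
    (k + 1 - δ / 3 * ((1 - t) ^ ml)⁻¹) * t ≤ alphaBound k ml δ := by
  refine le_csSup ⟨(k : ℝ) + 1, ?_⟩ ⟨t, ht, rfl⟩
  rintro _ ⟨u, ⟨hu0, hu1⟩, rfl⟩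
  have h1 : 0 ≤ δ / 3 * ((1 - u) ^ ml)⁻¹ := by
    have : 0 < 1 - u := by linarith
    positivity
  have h2 : (0 : ℝ) ≤ k := Nat.cast_nonneg k
  simp only
  nlinarith

theorem alphaBound_nonneg {k ml : ℕ} {δ : ℝ} (hδ : 0 < δ) : 0 ≤ alphaBound k ml δ := by
  have := le_alphaBound (k := k) (ml := ml) hδ (t := 0) (by simp)
  simpa using this

/-- For `t < 1`, solving `hr` for `r` turns `k - r` into the factor in the definition of
`alphaBound`. -/
theorem mul_le_alphaBound {k ml r : ℕ} {δ : ℝ} (hδ : 0 < δ) {t : ℝ} (ht0 : 0 ≤ t) (ht1 : t ≤ 1)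
    (hr : δ / 3 < ((r : ℝ) + 1) * (1 - t) ^ ml) : ((k : ℝ) - r) * t ≤ alphaBound k ml δ := by
  rcases ht1.lt_or_eq with h1 | rfl
  · refine le_trans ?_ (le_alphaBound hδ ⟨ht0, h1⟩)
    refine mul_le_mul_of_nonneg_right ?_ ht0
    have hq : 0 < (1 - t) ^ ml := pow_pos (by linarith) _
    have : δ / 3 * ((1 - t) ^ ml)⁻¹ < r + 1 := by
      rwa [← div_eq_mul_inv, div_lt_iff₀ hq]
    linarith
  · rcases Nat.eq_zero_or_pos ml with rfl | hml
    · simp only [pow_zero, mul_one] at hr ⊢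
      by_contra! hlt
      set c : ℝ := k + 1 - δ / 3
      set M := alphaBound k 0 δ
      have hM0 : 0 ≤ M := alphaBound_nonneg hδ
      have hc : M < c := hlt.trans (by simp only [c]; linarith)
      have hc0 : 0 < c := by linarith
      -- For `ml = 0` the function is `c * t`; this `t < 1` gives the midpoint of `M` and `c`,
      -- beyond the supposed supremum `M`.
      have := le_alphaBound (k := k) (ml := 0) hδ (t := (M + c) / (2 * c))
        ⟨by positivity, by rw [div_lt_one (by positivity)]; linarith⟩
      simp only [pow_zero, inv_one, mul_one] at this
      have h2 : c * ((M + c) / (2 * c)) = (M + c) / 2 := by field_simp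
      change c * ((M + c) / (2 * c)) ≤ M at this
      linarith
    · rw [sub_self, zero_pow hml.ne', mul_zero] at hr
      linarith

/-- The indices of the large masses can be split off such that the remaining mass is small. -/
theorem exists_subset_sum_le_alphaBound {ι : Type*} [DecidableEq ι] (F : Finset ι) (p : ι → ℝ)
    (hp0 : ∀ i, 0 ≤ p i) (hp1 : ∀ i, p i ≤ 1) (ml : ℕ) {δ : ℝ} (hδ : 0 < δ) :
    ∃ H ⊆ F, ∑ i ∈ H, (1 - p i) ^ ml ≤ δ / 3 ∧ ∑ i ∈ F \ H, p i ≤ alphaBound F.card ml δ := by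
  classical
  -- The candidates consist of heaviest indices and fit the union bound budget `δ / 3`. A largest
  -- one is taken, so adding the heaviest remaining `b` breaks the budget.
  let 𝓗 := F.powerset.filter fun H => ∑ i ∈ H, (1 - p i) ^ ml ≤ δ / 3 ∧
    ∀ a ∈ H, ∀ b ∈ F \ H, p b ≤ p a
  have hne : 𝓗.Nonempty := ⟨∅, Finset.mem_filter.2 ⟨by simp, by simpa using by positivity, by simp⟩⟩
  obtain ⟨H, hH, hmax⟩ := Finset.exists_max_image 𝓗 Finset.card hne
  obtain ⟨hHF, hHsum, hHup⟩ := Finset.mem_filter.1 hH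
  rw [Finset.mem_powerset] at hHF
  refine ⟨H, hHF, hHsum, ?_⟩
  rcases (F \ H).eq_empty_or_nonempty with he | hne'
  · rw [he, Finset.sum_empty]
    exact alphaBound_nonneg hδ
  obtain ⟨b, hb, hbmax⟩ := Finset.exists_max_image (F \ H) p hne'
  obtain ⟨hbF, hbH⟩ := Finset.mem_sdiff.1 hb
  have hbig : δ / 3 < ∑ i ∈ insert b H, (1 - p i) ^ ml := by
    by_contra! hle
    have hmem : insert b H ∈ 𝓗 := by
      refine Finset.mem_filter.2 ⟨Finset.mem_powerset.2 (Finset.insert_subset hbF hHF), hle, ?_⟩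
      intro a ha c hc
      obtain ⟨hcF, hcH⟩ := Finset.mem_sdiff.1 hc
      have hcH' : c ∈ F \ H :=
        Finset.mem_sdiff.2 ⟨hcF, fun h => hcH (Finset.mem_insert_of_mem h)⟩
      rcases Finset.mem_insert.1 ha with rfl | haH
      · exact hbmax c hcH'
      · exact hHup a haH c hcH'
    have := hmax _ hmem
    rw [Finset.card_insert_of_notMem hbH] at this
    omega
  have hle : ∑ i ∈ insert b H, (1 - p i) ^ ml ≤ ((H.card : ℝ) + 1) * (1 - p b) ^ ml := by
    calc ∑ i ∈ insert b H, (1 - p i) ^ ml ≤ ∑ _i ∈ insert b H, (1 - p b) ^ ml := by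
          refine Finset.sum_le_sum fun i hi => ?_
          refine pow_le_pow_left₀ (by linarith [hp1 i]) ?_ _
          rcases Finset.mem_insert.1 hi with rfl | hiH
          · exact le_rfl
          · linarith [hHup i hiH b hb]
      _ = _ := by
          rw [Finset.sum_const, Finset.card_insert_of_notMem hbH, nsmul_eq_mul]
          push_cast
          ring
  calc ∑ i ∈ F \ H, p i ≤ ∑ _i ∈ F \ H, p b := Finset.sum_le_sum hbmax
    _ = ((F.card : ℝ) - H.card) * p b := by
        rw [Finset.sum_const, Finset.card_sdiff_of_subset hHF, nsmul_eq_mul,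
          Nat.cast_sub (Finset.card_le_card hHF)]
    _ ≤ _ := mul_le_alphaBound hδ (hp0 b) (hp1 b) (hbig.trans_le hle)

-- The sample misses `A i` with probability `(1 - P (A i)) ^ ml`. By a union bound no index of `H`
-- is missed, so the missed mass is part of the small rest.
open Classical in
theorem measure_unseen_mass_gt_le {Ω : Type*} [MeasurableSpace Ω] (P : Measure Ω)
    [IsProbabilityMeasure P] {ι : Type*} (F : Finset ι) (A : ι → Set Ω)
    (hA : ∀ i ∈ F, MeasurableSet (A i)) (ml : ℕ) {δ : ℝ} (hδ : 0 < δ) :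
    Measure.pi (fun _ : Fin ml => P)
      {S | alphaBound F.card ml δ < ∑ i ∈ F with ∀ j, S j ∉ A i, P.real (A i)}
      ≤ ENNReal.ofReal (δ / 3) := by
  obtain ⟨H, hHF, hH1, hH2⟩ := exists_subset_sum_le_alphaBound F (fun i => P.real (A i))
    (fun i => measureReal_nonneg) (fun i => measureReal_le_one) ml hδ
  have hsub : {S : Fin ml → Ω |
      alphaBound F.card ml δ < ∑ i ∈ F with ∀ j, S j ∉ A i, P.real (A i)}
      ⊆ ⋃ i ∈ H, Set.univ.pi fun _ => (A i)ᶜ := by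
    intro S hS
    by_contra hno
    simp only [Set.mem_iUnion, not_exists, Set.mem_pi, Set.mem_univ, true_implies,
      Set.mem_compl_iff] at hno
    refine absurd hS (not_lt.2 (le_trans ?_ hH2))
    refine Finset.sum_le_sum_of_subset_of_nonneg ?_ fun i _ _ => measureReal_nonneg
    intro i hi
    obtain ⟨hiF, hi'⟩ := Finset.mem_filter.1 hi
    exact Finset.mem_sdiff.2 ⟨hiF, fun hiH => hno i hiH hi'⟩
  calc _ ≤ ∑ i ∈ H, Measure.pi (fun _ : Fin ml => P) (Set.univ.pi fun _ => (A i)ᶜ) :=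
        (measure_mono hsub).trans (measure_biUnion_finset_le _ _)
    _ = ∑ i ∈ H, ENNReal.ofReal ((1 - P.real (A i)) ^ ml) := by
        refine Finset.sum_congr rfl fun i hi => ?_
        rw [Measure.pi_pi, Finset.prod_const, Finset.card_univ, Fintype.card_fin,
          ENNReal.ofReal_pow (by linarith [measureReal_le_one (μ := P) (s := A i)]),
          ← probReal_compl_eq_one_sub (hA i (hHF hi)), ofReal_measureReal]
    _ = ENNReal.ofReal (∑ i ∈ H, (1 - P.real (A i)) ^ ml) := by
        rw [ENNReal.ofReal_sum_of_nonneg]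
        exact fun i _ => pow_nonneg (by linarith [measureReal_le_one (μ := P) (s := A i)]) _
    _ ≤ _ := ENNReal.ofReal_le_ofReal hH1

/-- The mass of the cells of a finite partition that a sample does not hit. -/
theorem measure_uncovered_gt_le {X κ : Type*} [MeasurableSpace X] (μ : Measure X)
    [IsProbabilityMeasure μ] (φ : X → κ) (hφ : ∀ V : Set κ, MeasurableSet (φ ⁻¹' V))
    (K : Finset κ) (hK : ∀ x, φ x ∈ K) (m : ℕ) (a : ℝ) :
    Measure.pi (fun _ : Fin m => μ)
      {S | ENNReal.ofReal a < μ {x | ∀ i, φ x ≠ φ (S i)}}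
      ≤ ENNReal.ofReal (2 ^ K.card * Real.exp (-(m * a))) := by
  classical
  -- Union bound over the possible sets `V` of hit values: if `V` leaves out mass more than `a`, all
  -- `m` points fall in it with probability at most `(1 - a) ^ m ≤ exp (-(m * a))`.
  let 𝒱 : Finset (Finset κ) := K.powerset.filter fun V : Finset κ => ENNReal.ofReal a < μ (φ ⁻¹' (V : Set κ))ᶜ
  have hsub : {S : Fin m → X | ENNReal.ofReal a < μ {x | ∀ i, φ x ≠ φ (S i)}}
      ⊆ ⋃ V ∈ 𝒱, Set.univ.pi fun _ => φ ⁻¹' (V : Set κ) := by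
    intro S hS
    simp only [Set.mem_iUnion]
    refine ⟨Finset.univ.image fun i => φ (S i), Finset.mem_filter.2 ⟨?_, ?_⟩, ?_⟩
    · rw [Finset.mem_powerset]
      intro v hv
      obtain ⟨i, _, rfl⟩ := Finset.mem_image.1 hv
      exact hK _
    · refine hS.trans_eq ?_
      congr 1
      ext x
      simp [eq_comm]
    · intro i _
      simp
  have hV : ∀ V ∈ 𝒱, Measure.pi (fun _ : Fin m => μ) (Set.univ.pi fun _ => φ ⁻¹' (V : Set κ))
      ≤ ENNReal.ofReal (Real.exp (-(m * a))) := by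
    intro V hV
    have h1 := (Finset.mem_filter.1 hV).2
    have h2 : a ≤ μ.real (φ ⁻¹' (V : Set κ))ᶜ := by
      by_contra! hlt
      refine absurd h1 (not_lt.2 ?_)
      rw [← ofReal_measureReal]
      exact ENNReal.ofReal_le_ofReal hlt.le
    rw [probReal_compl_eq_one_sub (hφ _)] at h2
    rw [Measure.pi_pi, Finset.prod_const, Finset.card_univ, Fintype.card_fin, ← ofReal_measureReal,
      ← ENNReal.ofReal_pow measureReal_nonneg]
    refine ENNReal.ofReal_le_ofReal ?_
    have h3 : μ.real (φ ⁻¹' (V : Set κ)) ≤ Real.exp (-a) := by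
      linarith [Real.add_one_le_exp (-a)]
    calc _ ≤ Real.exp (-a) ^ m := pow_le_pow_left₀ measureReal_nonneg h3 m
      _ = _ := by rw [← Real.exp_nat_mul]; congr 1; ring
  calc _ ≤ ∑ V ∈ 𝒱, Measure.pi (fun _ : Fin m => μ) (Set.univ.pi fun _ => φ ⁻¹' (V : Set κ)) :=
        (measure_mono hsub).trans (measure_biUnion_finset_le _ _)
    _ ≤ ∑ _V ∈ 𝒱, ENNReal.ofReal (Real.exp (-(m * a))) := Finset.sum_le_sum hV
    _ = 𝒱.card * ENNReal.ofReal (Real.exp (-(m * a))) := by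
        rw [Finset.sum_const, nsmul_eq_mul]
    _ ≤ (2 ^ K.card : ℕ) * ENNReal.ofReal (Real.exp (-(m * a))) := by
        gcongr
        exact (Finset.card_filter_le _ _).trans (Finset.card_powerset K).le
    _ = _ := by
        rw [ENNReal.ofReal_mul (by positivity), ENNReal.ofReal_pow (by norm_num)]
        simp

/-! ### Bounds for events that need not be measurable -/

/-- If every labeling of the points of `S` lies in `G`, then so does the random one. -/
theorem measure_forall_labeling_le {E Y : Type*} [MeasurableSpace E] [MeasurableSpace Y]
    [Countable Y] (P : Measure (E × Y)) [IsProbabilityMeasure P] {m : ℕ}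
    (G : Set (Fin m → E × Y)) :
    Measure.pi (fun _ : Fin m => P.fst) {S | ∀ y : Fin m → Y, (fun i => (S i, y i)) ∈ G}
      ≤ Measure.pi (fun _ : Fin m => P) G := by
  -- The measurable hull makes the condition over the countably many labelings measurable, as the
  -- measure-preserving projection requires.
  set G' := toMeasurable (Measure.pi fun _ : Fin m => P) G
  have hmp : MeasurePreserving (fun (z : Fin m → E × Y) i => (z i).1)
      (Measure.pi fun _ : Fin m => P) (Measure.pi fun _ : Fin m => P.fst) :=
    measurePreserving_pi (fun _ => P) (fun _ => P.fst) (f := fun _ => Prod.fst)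
      fun _ => ⟨measurable_fst, rfl⟩
  have hBm : MeasurableSet {S : Fin m → E | ∀ y : Fin m → Y, (fun i => (S i, y i)) ∈ G'} := by
    have : {S : Fin m → E | ∀ y : Fin m → Y, (fun i => (S i, y i)) ∈ G'}
        = ⋂ y : Fin m → Y, (fun S : Fin m → E => fun i => (S i, y i)) ⁻¹' G' := by
      ext; simp
    rw [this]
    refine MeasurableSet.iInter fun y => ?_
    refine measurableSet_preimage ?_ (measurableSet_toMeasurable _ _)
    exact measurable_pi_lambda _ fun i => (measurable_pi_apply i).prodMk measurable_const
  calc _ ≤ Measure.pi (fun _ : Fin m => P.fst)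
        {S | ∀ y : Fin m → Y, (fun i => (S i, y i)) ∈ G'} :=
        measure_mono fun S (hS : ∀ y : Fin m → Y, (fun i => (S i, y i)) ∈ G) y =>
          subset_toMeasurable _ _ (hS y)
    _ = Measure.pi (fun _ : Fin m => P) _ := (hmp.measure_preimage hBm.nullMeasurableSet).symm
    _ ≤ Measure.pi (fun _ : Fin m => P) G' :=
        measure_mono fun z (hz : ∀ y : Fin m → Y, (fun i => ((z i).1, y i)) ∈ G') =>
          hz fun i => (z i).2
    _ = _ := measure_toMeasurable _

/-- A bound on the sections of a set that depend on the first component only through a statistic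
with countably many values. -/
theorem measure_prod_le_of_statistic {X Y κ : Type*} [MeasurableSpace X] [MeasurableSpace Y]
    [Countable κ] (μ : Measure X) [IsProbabilityMeasure μ] (ν : Measure Y) [SFinite ν]
    (T : X → κ) (hT : ∀ t, MeasurableSet (T ⁻¹' {t})) {D : Set (X × Y)}
    (hD : ∀ x x', T x = T x' → ∀ y, (x, y) ∈ D → (x', y) ∈ D) {c : ℝ≥0∞}
    (hc : ∀ x, ν {y | (x, y) ∈ D} ≤ c) : (μ.prod ν) D ≤ c := by
  -- All sections over one fiber of `T` coincide, so `B t` is a single section or empty; countably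
  -- many rectangles cover `D` without measurability of `D`.
  let B : κ → Set Y := fun t => {y | ∃ x, T x = t ∧ (x, y) ∈ D}
  have hB : ∀ t, ν (B t) ≤ c := by
    intro t
    by_cases h : ∃ x, T x = t
    · obtain ⟨x, rfl⟩ := h
      refine (measure_mono ?_).trans (hc x)
      rintro y ⟨x', hx', hy⟩
      exact hD x' x hx' y hy
    · have : B t = ∅ := by
        ext y
        simp only [B, Set.mem_ofPred_eq, Set.mem_empty_iff_false, iff_false]
        rintro ⟨x, hx, _⟩
        exact h ⟨x, hx⟩
      simp [this]
  have hsub : D ⊆ ⋃ t, (T ⁻¹' {t}) ×ˢ B t := by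
    rintro ⟨x, y⟩ hxy
    exact Set.mem_iUnion.2 ⟨T x, rfl, x, rfl, hxy⟩
  calc (μ.prod ν) D ≤ ∑' t, (μ.prod ν) ((T ⁻¹' {t}) ×ˢ B t) :=
        (measure_mono hsub).trans (measure_iUnion_le _)
    _ ≤ ∑' t, μ (T ⁻¹' {t}) * c := by
        refine ENNReal.tsum_le_tsum fun t => ?_
        rw [Measure.prod_prod]
        gcongr
        exact hB t
    _ = μ (⋃ t, T ⁻¹' {t}) * c := by
        rw [ENNReal.tsum_mul_right, measure_iUnion _ hT]
        intro t t' htt'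
        exact Disjoint.preimage _ (by simpa using htt')
    _ ≤ 1 * c := by gcongr; exact prob_le_one
    _ = c := one_mul c

end ClusterLearning

/-! ### Geometry of the grid and of the regions -/

namespace ClusterLearning

variable {n : ℕ}

/-- The multi-index of the grid hypercube that contains `x`. -/
noncomputable def gridIdx (s : ℝ) (x : EuclideanSpace ℝ (Fin n)) : Fin n → ℕ :=
  fun i => gridIndex s (x i)

theorem mem_cell_iff {s : ℝ} {x x' : EuclideanSpace ℝ (Fin n)} :
    x' ∈ cell s x ↔ x' ∈ unitCube n ∧ gridIdx s x' = gridIdx s x := by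
  simp [cell, gridIdx, funext_iff]

theorem cell_eq_of_gridIdx_eq {s : ℝ} {x x' : EuclideanSpace ℝ (Fin n)}
    (h : gridIdx s x = gridIdx s x') : cell s x = cell s x' := by
  ext z
  rw [mem_cell_iff, mem_cell_iff, h]

theorem mem_cell_self {s : ℝ} {x : EuclideanSpace ℝ (Fin n)} (hx : x ∈ unitCube n) :
    x ∈ cell s x := mem_cell_iff.2 ⟨hx, rfl⟩

theorem gridIndex_lt {N : ℕ} (hN : 0 < N) {s : ℝ} (hs : s = 1 / (N : ℝ)) (t : ℝ) :
    gridIndex s t < N := by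
  subst hs
  rw [gridIndex, one_div_one_div, Nat.floor_natCast]
  omega

theorem gridIndex_le_mul {N : ℕ} {s : ℝ} (hs : s = 1 / (N : ℝ)) {t : ℝ}
    (ht : t ∈ Set.Icc (0 : ℝ) 1) : (gridIndex s t : ℝ) ≤ t * N := by
  subst hs
  have h0 : 0 ≤ t * N := mul_nonneg ht.1 (Nat.cast_nonneg N)
  have h1 : gridIndex (1 / (N : ℝ)) t ≤ ⌊t * N⌋₊ := by
    rw [gridIndex, div_div_eq_mul_div, div_one]
    exact min_le_left _ _
  exact (Nat.cast_le.2 h1).trans (Nat.floor_le h0)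

theorem mul_le_gridIndex_add_one {N : ℕ} (hN : 0 < N) {s : ℝ} (hs : s = 1 / (N : ℝ)) {t : ℝ}
    (ht : t ∈ Set.Icc (0 : ℝ) 1) : t * N ≤ gridIndex s t + 1 := by
  subst hs
  rw [gridIndex, div_div_eq_mul_div, div_one, one_div_one_div, Nat.floor_natCast]
  rcases min_choice ⌊t * N⌋₊ (N - 1) with h | h <;> rw [h]
  · exact (Nat.lt_floor_add_one _).le
  -- In the last grid interval the point `t = 1` attains equality.
  · rw [Nat.cast_sub hN]
    have : t * N ≤ 1 * N := mul_le_mul_of_nonneg_right ht.2 (Nat.cast_nonneg N)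
    push_cast
    linarith

theorem dist_le_sepParam {N : ℕ} (hN : 0 < N) {s : ℝ} (hs : s = 1 / (N : ℝ))
    {x x' : EuclideanSpace ℝ (Fin n)} (hx : x ∈ unitCube n) (hx' : x' ∈ unitCube n)
    (h : gridIdx s x = gridIdx s x') : dist x x' ≤ sepParam n s := by
  have hN' : (0 : ℝ) < N := by exact_mod_cast hN
  have hs0 : 0 ≤ s := by rw [hs]; positivity
  have hcoord : ∀ i, dist (x i) (x' i) ^ 2 ≤ s ^ 2 := by
    intro i
    refine pow_le_pow_left₀ dist_nonneg ?_ 2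
    have hi : gridIndex s (x i) = gridIndex s (x' i) := congrFun h i
    have h1 := gridIndex_le_mul hs (hx i)
    have h2 := mul_le_gridIndex_add_one hN hs (hx i)
    have h3 := gridIndex_le_mul hs (hx' i)
    have h4 := mul_le_gridIndex_add_one hN hs (hx' i)
    rw [← hi] at h3 h4
    rw [Real.dist_eq, hs, le_div_iff₀ hN', ← abs_of_pos hN', ← abs_mul, abs_le]
    constructor <;> linarith
  rw [EuclideanSpace.dist_eq]
  calc √(∑ i, dist (x i) (x' i) ^ 2) ≤ √(∑ _i : Fin n, s ^ 2) :=
        Real.sqrt_le_sqrt (Finset.sum_le_sum fun i _ => hcoord i)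
    _ = sepParam n s := by
        rw [Finset.sum_const, Finset.card_univ, Fintype.card_fin, nsmul_eq_mul,
          Real.sqrt_mul (Nat.cast_nonneg n), Real.sqrt_sq hs0, sepParam, mul_comm]

theorem measurableSet_unitCube : MeasurableSet (unitCube n) := by
  have : unitCube n = ⋂ i, {x : EuclideanSpace ℝ (Fin n) | x i ∈ Set.Icc (0 : ℝ) 1} := by
    ext; simp [unitCube]
  rw [this]
  refine MeasurableSet.iInter fun i => ?_
  have hm : Measurable fun x : EuclideanSpace ℝ (Fin n) => x i := by fun_prop
  exact hm measurableSet_Icc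

theorem measurable_gridIdx (s : ℝ) :
    Measurable (gridIdx s : EuclideanSpace ℝ (Fin n) → Fin n → ℕ) := by
  refine measurable_pi_lambda _ fun i => ?_
  have hm : Measurable fun x : EuclideanSpace ℝ (Fin n) => x i / s := by fun_prop
  exact (Nat.measurable_floor.comp hm).min measurable_const

theorem measurableSet_cell (s : ℝ) (x : EuclideanSpace ℝ (Fin n)) :
    MeasurableSet (cell s x) := by
  have : cell s x = unitCube n ∩ gridIdx s ⁻¹' {gridIdx s x} := by
    ext z
    rw [mem_cell_iff]
    rfl
  rw [this]
  exact measurableSet_unitCube.inter (measurable_gridIdx s (measurableSet_singleton _))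

variable {m : ℕ} {s : ℝ} {S : Fin m → EuclideanSpace ℝ (Fin n)}

theorem mem_region_iff {i : Fin m} {x : EuclideanSpace ℝ (Fin n)} :
    x ∈ region s S i ↔ ∃ j, (sampleGraph s S).Reachable i j ∧ x ∈ cell s (S j) := by
  simp [region]

theorem measurableSet_region (i : Fin m) : MeasurableSet (region s S i) :=
  MeasurableSet.biUnion (Set.to_countable _) fun j _ => measurableSet_cell s (S j)

theorem mem_regions_iff {A : Set (EuclideanSpace ℝ (Fin n))} :
    A ∈ regions s S ↔ ∃ i, region s S i = A := by
  simp [regions]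

theorem measurableSet_of_mem_regions {A : Set (EuclideanSpace ℝ (Fin n))}
    (hA : A ∈ regions s S) : MeasurableSet A := by
  obtain ⟨i, rfl⟩ := mem_regions_iff.1 hA
  exact measurableSet_region i

theorem cell_subset_region (i : Fin m) : cell s (S i) ⊆ region s S i :=
  fun _ hx => mem_region_iff.2 ⟨i, SimpleGraph.Reachable.refl i, hx⟩

theorem cell_subset_of_mem_region {i : Fin m} {x : EuclideanSpace ℝ (Fin n)}
    (hx : x ∈ region s S i) : cell s x ⊆ region s S i := by
  obtain ⟨j, hj, hxj⟩ := mem_region_iff.1 hx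
  intro z hz
  refine mem_region_iff.2 ⟨j, hj, ?_⟩
  rwa [← cell_eq_of_gridIdx_eq (mem_cell_iff.1 hxj).2]

theorem reachable_of_dist_le {i j : Fin m} (h : dist (S i) (S j) ≤ sepParam n s) :
    (sampleGraph s S).Reachable i j := by
  by_cases hij : i = j
  · rw [hij]
  · exact SimpleGraph.Adj.reachable ⟨hij, h⟩

theorem region_eq_of_reachable {i j : Fin m} (h : (sampleGraph s S).Reachable i j) :
    region s S i = region s S j := by
  ext x
  rw [mem_region_iff, mem_region_iff]
  exact exists_congr fun k => and_congr_left fun _ => ⟨h.symm.trans, h.trans⟩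

variable {N : ℕ}

/-- Sample points in a common cell are within its diameter `γ`, hence in one component. So distinct
regions are disjoint. -/
theorem region_eq_of_mem (hN : 0 < N) (hs : s = 1 / (N : ℝ)) (hS : ∀ i, S i ∈ unitCube n)
    {i j : Fin m} {x : EuclideanSpace ℝ (Fin n)} (hi : x ∈ region s S i)
    (hj : x ∈ region s S j) : region s S i = region s S j := by
  obtain ⟨a, ha, hxa⟩ := mem_region_iff.1 hi
  obtain ⟨b, hb, hxb⟩ := mem_region_iff.1 hj
  have hab : (sampleGraph s S).Reachable a b := reachable_of_dist_le <|
    dist_le_sepParam hN hs (hS a) (hS b)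
      ((mem_cell_iff.1 hxa).2.symm.trans (mem_cell_iff.1 hxb).2)
  exact region_eq_of_reachable ((ha.trans hab).trans hb.symm)

theorem eq_of_mem_regions (hN : 0 < N) (hs : s = 1 / (N : ℝ)) (hS : ∀ i, S i ∈ unitCube n)
    {A B : Set (EuclideanSpace ℝ (Fin n))} (hA : A ∈ regions s S) (hB : B ∈ regions s S)
    {x : EuclideanSpace ℝ (Fin n)} (hxA : x ∈ A) (hxB : x ∈ B) : A = B := by
  obtain ⟨i, rfl⟩ := mem_regions_iff.1 hA
  obtain ⟨j, rfl⟩ := mem_regions_iff.1 hB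
  exact region_eq_of_mem hN hs hS hxA hxB

/-- For `N = 1` there is one cell, so all sample points are within `γ` of each other. -/
theorem two_le_of_two_le_card_regions (hN : 0 < N) (hs : s = 1 / (N : ℝ))
    (hS : ∀ i, S i ∈ unitCube n) (hcard : 2 ≤ (regions s S).card) : 2 ≤ N := by
  by_contra! hlt
  obtain ⟨A, hA, B, hB, hAB⟩ := Finset.one_lt_card.1 hcard
  obtain ⟨i, rfl⟩ := mem_regions_iff.1 hA
  obtain ⟨j, rfl⟩ := mem_regions_iff.1 hB
  refine hAB (region_eq_of_reachable (reachable_of_dist_le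
    (dist_le_sepParam hN hs (hS i) (hS j) ?_)))
  funext k
  have h1 := gridIndex_lt hN hs (S i k)
  have h2 := gridIndex_lt hN hs (S j k)
  simp only [gridIdx]
  omega

theorem card_regions_le : (regions s S).card ≤ m := by
  unfold regions
  exact Finset.card_image_le.trans (by simp)

/-! ### Regions, supported paths and the property class -/

variable {μ : Measure (EuclideanSpace ℝ (Fin n))}

theorem GammaConnected.step {x x' z : EuclideanSpace ℝ (Fin n)} (h : GammaConnected s μ x x')
    (hz : z ∈ μ.support) (hd : dist x' z ≤ sepParam n s) : GammaConnected s μ x z := by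
  obtain ⟨G, q, hq0, hqG, hstep, hsupp⟩ := h
  refine ⟨G + 1, fun i => if i ≤ G then q i else z, by simpa using hq0, by simp, ?_, ?_⟩
  · intro i hi
    rcases (Nat.lt_succ_iff.1 hi).lt_or_eq with h | rfl
    · simpa [h.le, Nat.succ_le_iff.2 h] using hstep i h
    · simpa [hqG] using hd
  · intro i _
    by_cases h : i ≤ G
    · simpa [h] using hsupp i h
    · simpa [h] using hz

theorem gammaConnected_refl {x : EuclideanSpace ℝ (Fin n)} (hx : x ∈ μ.support) :
    GammaConnected s μ x x :=
  ⟨0, fun _ => x, rfl, rfl, fun i hi => absurd hi (Nat.not_lt_zero i), fun _ _ => hx⟩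

/-- The path steps from `x` to a sample point in its cell, follows edges of the sample graph, and
steps from a sample point to `x'` in the same cell. -/
theorem gammaConnected_of_mem_region (hN : 0 < N) (hs : s = 1 / (N : ℝ))
    (hS : ∀ i, S i ∈ unitCube n) (hSμ : ∀ i, S i ∈ μ.support) {i : Fin m}
    {x x' : EuclideanSpace ℝ (Fin n)} (hx : x ∈ region s S i) (hx' : x' ∈ region s S i)
    (hxμ : x ∈ μ.support) (hxμ' : x' ∈ μ.support) : GammaConnected s μ x x' := by
  obtain ⟨a, ha, hxa⟩ := mem_region_iff.1 hx
  obtain ⟨b, hb, hxb⟩ := mem_region_iff.1 hx'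
  have hd : ∀ {z : EuclideanSpace ℝ (Fin n)} {c : Fin m}, z ∈ cell s (S c) →
      dist z (S c) ≤ sepParam n s := fun {z c} hz =>
    dist_le_sepParam hN hs (mem_cell_iff.1 hz).1 (hS c) (mem_cell_iff.1 hz).2
  have hab := (SimpleGraph.reachable_iff_reflTransGen a b).1 (ha.symm.trans hb)
  have key : ∀ c, Relation.ReflTransGen (sampleGraph s S).Adj a c →
      GammaConnected s μ x (S c) := by
    intro c hc
    induction hc with
    | refl => exact (gammaConnected_refl hxμ).step (hSμ a) (hd hxa)
    | tail _ hadj ih =>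
      exact ih.step (hSμ _) hadj.2
  exact (key b hab).step hxμ' (by rw [dist_comm]; exact hd hxb)

theorem riskA_le_measure_compl (hN : 0 < N) (hs : s = 1 / (N : ℝ)) (hS : ∀ i, S i ∈ unitCube n)
    (hSμ : ∀ i, S i ∈ μ.support) (hcard : 2 ≤ (regions s S).card) :
    riskA s μ ≤ μ (⋃ A ∈ regions s S, A)ᶜ := by
  let e := (regions s S).equivFin
  let X : Fin (regions s S).card → Set (EuclideanSpace ℝ (Fin n)) := fun i => (e.symm i).1
  have hX : ∀ i, ∃ j, region s S j = X i := fun i => mem_regions_iff.1 (e.symm i).2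
  have hfam : IsClusterFamily s μ X := by
    -- The generators of a region are the sample points of its component; different components are
    -- more than `γ` apart.
    refine ⟨hcard, ⟨fun i => {t | ∃ j, S j = t ∧ region s S j = X i}, ?_, ?_⟩, ?_⟩
    · intro i
      obtain ⟨j, hj⟩ := hX i
      refine ⟨⟨S j, j, rfl, hj⟩, ?_, ?_⟩
      · rintro _ ⟨k, rfl, _⟩
        exact ⟨hSμ k, hS k⟩
      · ext x
        simp only [Set.mem_iUnion, Set.mem_ofPred_eq, exists_prop]
        constructor
        · intro hx
          rw [← hj] at hx
          obtain ⟨k, hk, hxk⟩ := mem_region_iff.1 hx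
          exact ⟨S k, ⟨k, rfl, (region_eq_of_reachable hk).symm.trans hj⟩, hxk⟩
        · rintro ⟨_, ⟨k, rfl, hk⟩, hx⟩
          rw [← hk]
          exact cell_subset_region k hx
    · rintro i j hij _ ⟨a, rfl, ha⟩ _ ⟨b, rfl, hb⟩
      by_contra! hle
      refine hij (e.symm.injective (Subtype.ext ?_))
      exact ha.symm.trans ((region_eq_of_reachable (reachable_of_dist_le hle)).trans hb)
    · intro i x hx
      obtain ⟨j, hj⟩ := hX i
      rw [← hj] at hx
      obtain ⟨k, _, hxk⟩ := mem_region_iff.1 hx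
      obtain ⟨hxc, hxi⟩ := mem_cell_iff.1 hxk
      exact ⟨S k, hSμ k, dist_le_sepParam hN hs hxc (hS k) hxi⟩
  have hU : (⋃ i, X i) = ⋃ A ∈ regions s S, A := by
    ext x
    simp only [Set.mem_iUnion, exists_prop]
    constructor
    · rintro ⟨i, hi⟩
      exact ⟨X i, (e.symm i).2, hi⟩
    · rintro ⟨A, hA, hx⟩
      exact ⟨e ⟨A, hA⟩, by simpa [X] using hx⟩
  rw [← hU]
  exact iInf_le_of_le _ (iInf_le_of_le X (iInf_le_of_le hfam le_rfl))

theorem measure_compl_regions_le (hcube : ∀ᵐ x ∂μ, x ∈ unitCube n) :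
    μ (⋃ A ∈ regions s S, A)ᶜ ≤ μ {x | ∀ i, gridIdx s x ≠ gridIdx s (S i)} := by
  refine measure_mono_ae ?_
  filter_upwards [hcube] with x hx hxU i hi
  refine hxU (Set.mem_iUnion₂.2 ⟨region s S i, mem_regions_iff.2 ⟨i, rfl⟩, ?_⟩)
  exact cell_subset_region i (mem_cell_iff.2 ⟨hx, hi⟩)

end ClusterLearning

/-! ### Labels of the regions and learning with cluster features -/

namespace ClusterLearning

variable {n m ml N : ℕ} {s : ℝ} {S : Fin m → EuclideanSpace ℝ (Fin n)}

/-- A labeled point outside of the exceptional null sets of `P`. -/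
def IsRegularPoint (s : ℝ) (P : Measure (EuclideanSpace ℝ (Fin n) × Fin 2))
    (z : EuclideanSpace ℝ (Fin n) × Fin 2) : Prop :=
  z.1 ∈ unitCube n ∧ z.1 ∈ P.fst.support ∧ z ∈ P.support ∧ P (cell s z.1 ×ˢ {z.2}) ≠ 0

/-- There are countably many pairs of a cell and a label, so those of mass zero are avoided
simultaneously. -/
theorem ae_isRegularPoint (s : ℝ) (P : Measure (EuclideanSpace ℝ (Fin n) × Fin 2))
    (hcube : ∀ᵐ z ∂P, z.1 ∈ unitCube n) : ∀ᵐ z ∂P, IsRegularPoint s P z := by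
  have hcells : ∀ᵐ z ∂P, ∀ (c : Fin n → ℕ) (y : Fin 2),
      P ((unitCube n ∩ gridIdx s ⁻¹' {c}) ×ˢ {y}) = 0 →
        z ∉ (unitCube n ∩ gridIdx s ⁻¹' {c}) ×ˢ ({y} : Set (Fin 2)) := by
    rw [ae_all_iff]
    intro c
    rw [ae_all_iff]
    intro y
    by_cases h : P ((unitCube n ∩ gridIdx s ⁻¹' {c}) ×ˢ {y}) = 0
    · filter_upwards [measure_eq_zero_iff_ae_notMem.1 h] with z hz _ using hz
    · exact Filter.Eventually.of_forall fun z hz => absurd hz h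
  have hfst : ∀ᵐ z ∂P, z.1 ∈ P.fst.support := by
    have : ∀ᵐ x ∂(P.map Prod.fst), x ∈ P.fst.support := Measure.support_mem_ae
    exact ae_of_ae_map measurable_fst.aemeasurable this
  filter_upwards [hcube, hfst, Measure.support_mem_ae (μ := P), hcells] with z h1 h2 h3 h4
  refine ⟨h1, h2, h3, fun h0 => ?_⟩
  have hcell : cell s z.1 = unitCube n ∩ gridIdx s ⁻¹' {gridIdx s z.1} := by
    ext x
    rw [mem_cell_iff]
    rfl
  rw [hcell] at h0
  exact h4 _ _ h0 ⟨⟨h1, rfl⟩, rfl⟩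

variable {P : Measure (EuclideanSpace ℝ (Fin n) × Fin 2)}

/-- Where the cluster-label assumption is exact, no region carries both labels. -/
theorem measure_region_label_eq_zero [IsProbabilityMeasure P] (hN : 0 < N)
    (hs : s = 1 / (N : ℝ)) (hS : ∀ i, S i ∈ unitCube n) (hSμ : ∀ i, S i ∈ P.fst.support)
    (hB : riskB s P = 0) {A : Set (EuclideanSpace ℝ (Fin n))} (hA : A ∈ regions s S)
    {y y' : Fin 2} (hy : y ≠ y') (hAy : P (A ×ˢ {y}) ≠ 0) : P (A ×ˢ {y'}) = 0 := by
  obtain ⟨i, rfl⟩ := mem_regions_iff.1 hA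
  have hsupp : ∀ c : Fin 2, P (region s S i ×ˢ {c})
      ≤ P ((region s S i ∩ P.fst.support) ×ˢ {c}) := by
    intro c
    refine measure_mono_ae ?_
    have : ∀ᵐ z ∂P, z.1 ∈ P.fst.support := by
      have : ∀ᵐ x ∂(P.map Prod.fst), x ∈ P.fst.support := Measure.support_mem_ae
      exact ae_of_ae_map measurable_fst.aemeasurable this
    filter_upwards [this] with z hz hzc
    exact ⟨⟨hzc.1, hz⟩, hzc.2⟩
  -- Two independent draws from these sets are connected and differ in label, an event of
  -- probability `R_B = 0`.
  have hprod : P ((region s S i ∩ P.fst.support) ×ˢ {y})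
      * P ((region s S i ∩ P.fst.support) ×ˢ {y'}) = 0 := by
    rw [← Measure.prod_prod]
    refine measure_mono_null ?_ hB
    rintro ⟨z, z'⟩ ⟨⟨⟨hz1, hz2⟩, hz3⟩, ⟨⟨hz1', hz2'⟩, hz3'⟩⟩
    refine ⟨gammaConnected_of_mem_region hN hs hS hSμ hz1 hz1' hz2 hz2', ?_⟩
    exact fun h => hy ((Set.mem_singleton_iff.1 hz3).symm.trans (h.trans hz3'))
  rcases mul_eq_zero.1 hprod with h | h
  · exact absurd (le_antisymm ((hsupp y).trans h.le) zero_le) hAy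
  · exact le_antisymm ((hsupp y').trans h.le) zero_le

/-- The region contains the whole cell of the point. This lets a single labeled point decide the
label of its region. -/
theorem IsRegularPoint.measure_region_ne_zero {z : EuclideanSpace ℝ (Fin n) × Fin 2}
    (hz : IsRegularPoint s P z) {A : Set (EuclideanSpace ℝ (Fin n))} (hA : A ∈ regions s S)
    (hzA : z.1 ∈ A) : P (A ×ˢ {z.2}) ≠ 0 := by
  obtain ⟨i, rfl⟩ := mem_regions_iff.1 hA
  intro h0
  exact hz.2.2.2 (measure_mono_null (Set.prod_mono (cell_subset_of_mem_region hzA) le_rfl) h0)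

/-- Any labels of the regions and of the rest are attained by a linear classifier on the
features. -/
theorem exists_linearClassifier_featureMap {Xa : Finset (Set (EuclideanSpace ℝ (Fin n)))}
    (hdisj : ∀ A ∈ Xa, ∀ B ∈ Xa, ∀ x, x ∈ A → x ∈ B → A = B)
    (l : Set (EuclideanSpace ℝ (Fin n)) → Fin 2) (c : Fin 2) :
    ∃ g ∈ linearClassifiers Xa, (∀ A ∈ Xa, ∀ x ∈ A, g (featureMap Xa x) = l A) ∧ g 0 = c := by
  classical
  -- The weights `±2` outweigh the offset `0` or `-1`, which alone decides the label of the zero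
  -- vector.
  let w : EuclideanSpace ℝ Xa := WithLp.toLp 2 fun A => if l A.1 = 1 then 2 else -2
  let b : ℝ := if c = 1 then 0 else -1
  refine ⟨halfspaceClassifier (w, b), mem_linearClassifiers_iff.2 ⟨_, rfl⟩, ?_, ?_⟩
  · intro A hA x hx
    have hinner : inner ℝ w (featureMap Xa x) = if l A = 1 then (2 : ℝ) else -2 := by
      rw [PiLp.inner_apply, Finset.sum_eq_single (⟨A, hA⟩ : Xa)]
      · simp [w, featureMap, hx]
      · intro B _ hBA
        have hxB : x ∉ B.1 := fun h => hBA (Subtype.ext (hdisj B.1 B.2 A hA x h hx))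
        simp [featureMap, hxB]
      · simp
    simp only [halfspaceClassifier, hinner, b]
    generalize l A = a
    fin_cases a <;> fin_cases c <;> norm_num
  · simp only [halfspaceClassifier, inner_zero_right, b]
    fin_cases c <;> norm_num

theorem featureMap_eq_zero {Xa : Finset (Set (EuclideanSpace ℝ (Fin n)))}
    {x : EuclideanSpace ℝ (Fin n)} (hx : ∀ A ∈ Xa, x ∉ A) : featureMap Xa x = 0 := by
  ext A
  simp [featureMap, hx A.1 A.2]

theorem featureMap_eq_of_mem {Xa : Finset (Set (EuclideanSpace ℝ (Fin n)))}
    (hdisj : ∀ A ∈ Xa, ∀ B ∈ Xa, ∀ x, x ∈ A → x ∈ B → A = B)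
    {A : Set (EuclideanSpace ℝ (Fin n))} (hA : A ∈ Xa) {x x' : EuclideanSpace ℝ (Fin n)}
    (hx : x ∈ A) (hx' : x' ∈ A) : featureMap Xa x = featureMap Xa x' := by
  ext B
  have : x ∈ B.1 ↔ x' ∈ B.1 := by
    constructor <;> intro h
    · rwa [← hdisj A hA B.1 B.2 x hx h]
    · rwa [← hdisj A hA B.1 B.2 x' hx' h]
  by_cases h : x ∈ B.1
  · simp [featureMap, h, this.1 h]
  · simp [featureMap, h, mt this.2 h]

theorem measurable_featureMap {Xa : Finset (Set (EuclideanSpace ℝ (Fin n)))}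
    (hXa : ∀ A ∈ Xa, MeasurableSet A) : Measurable (featureMap Xa) := by
  refine (WithLp.measurable_toLp 2 _).comp (measurable_pi_lambda _ fun A => ?_)
  exact Measurable.ite (hXa A.1 A.2) measurable_const measurable_const

theorem zeroOneLoss_nonneg (y y' : Fin 2) : 0 ≤ zeroOneLoss y y' := by
  unfold zeroOneLoss
  split_ifs <;> norm_num

theorem zeroOneLoss_le_one (y y' : Fin 2) : zeroOneLoss y y' ≤ 1 := by
  unfold zeroOneLoss
  split_ifs <;> norm_num

theorem zeroOneLoss_self (y : Fin 2) : zeroOneLoss y y = 0 := by simp [zeroOneLoss]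

/-- Empirical risk minimization on the features makes no error on sample points in the regions. -/
theorem IsERM.eq_label_of_mem {Xa : Finset (Set (EuclideanSpace ℝ (Fin n)))}
    (hdisj : ∀ A ∈ Xa, ∀ B ∈ Xa, ∀ x, x ∈ A → x ∈ B → A = B)
    {Z : Fin ml → EuclideanSpace ℝ (Fin n) × Fin 2}
    (hpure : ∀ A ∈ Xa, ∀ j k, (Z j).1 ∈ A → (Z k).1 ∈ A → (Z j).2 = (Z k).2)
    {hZ : EuclideanSpace ℝ Xa → Fin 2}
    (herm : IsERM (linearClassifiers Xa) (fun i => (featureMap Xa (Z i).1, (Z i).2)) hZ)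
    {A : Set (EuclideanSpace ℝ (Fin n))} (hA : A ∈ Xa) {j : Fin ml} (hj : (Z j).1 ∈ A) :
    hZ (featureMap Xa (Z j).1) = (Z j).2 := by
  classical
  let l : Set (EuclideanSpace ℝ (Fin n)) → Fin 2 := fun B =>
    if h : ∃ k, (Z k).1 ∈ B then (Z h.choose).2 else 0
  have hl : ∀ B ∈ Xa, ∀ k, (Z k).1 ∈ B → l B = (Z k).2 := by
    intro B hB k hk
    have h : ∃ k, (Z k).1 ∈ B := ⟨k, hk⟩
    simp only [l, dif_pos h]
    exact hpure B hB _ _ h.choose_spec hk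
  -- The competitor `g` agrees with `hZ` at `0`, so sample points outside the regions cost both the
  -- same, while `g` makes no error inside.
  obtain ⟨g, hg, hgl, hg0⟩ := exists_linearClassifier_featureMap hdisj l (hZ 0)
  have hgk : ∀ B ∈ Xa, ∀ k, (Z k).1 ∈ B → g (featureMap Xa (Z k).1) = (Z k).2 :=
    fun B hB k hk => (hgl B hB _ hk).trans (hl B hB k hk)
  by_contra hne
  have hml : (0 : ℝ) < ml := by exact_mod_cast j.pos
  refine absurd (herm.2 g hg) (not_le.2 ?_)
  unfold empRisk
  refine div_lt_div_of_pos_right (Finset.sum_lt_sum (fun k _ => ?_) ⟨j, Finset.mem_univ j, ?_⟩) hml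
  · by_cases hk : ∃ B ∈ Xa, (Z k).1 ∈ B
    · obtain ⟨B, hB, hkB⟩ := hk
      simp only [hgk B hB k hkB, zeroOneLoss_self]
      exact zeroOneLoss_nonneg _ _
    · have h0 : featureMap Xa (Z k).1 = 0 :=
        featureMap_eq_zero fun B hB hkB => hk ⟨B, hB, hkB⟩
      simp only [h0, hg0, le_refl]
  · simp only [hgk A hA j hj, zeroOneLoss_self]
    simp [zeroOneLoss, hne]

theorem risk_nonneg {E : Type*} [MeasurableSpace E] (P : Measure (E × Fin 2)) (h : E → Fin 2) :
    0 ≤ risk P h :=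
  integral_nonneg fun _ => zeroOneLoss_nonneg _ _

theorem empRisk_le_one {E : Type*} (Z : Fin m → E × Fin 2) (h : E → Fin 2) :
    empRisk Z h ≤ 1 := by
  unfold empRisk
  refine div_le_one_of_le₀ ?_ (Nat.cast_nonneg m)
  calc ∑ i, zeroOneLoss (h (Z i).1) (Z i).2 ≤ ∑ _i : Fin m, (1 : ℝ) :=
        Finset.sum_le_sum fun i _ => zeroOneLoss_le_one _ _
    _ = m := by simp

/-- The class may be infinite, but on the sample it shows only finitely many label patterns. -/
theorem exists_isERM {E : Type*} {H : Set (E → Fin 2)} (hH : H.Nonempty)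
    (Z : Fin m → E × Fin 2) : ∃ h, IsERM H Z h := by
  let v : (E → Fin 2) → Fin m → Fin 2 := fun h i => h (Z i).1
  obtain ⟨_, ⟨h, hh, rfl⟩, hmin⟩ := Set.exists_min_image (v '' H)
    (fun a => (∑ i, zeroOneLoss (a i) (Z i).2) / (m : ℝ)) (Set.toFinite _) (hH.image v)
  exact ⟨h, hh, fun g hg => hmin _ ⟨g, hg, rfl⟩⟩

open Classical in
/-- The risk with cluster features is at most the uncovered mass plus the mass of the regions that
the labeled sample does not hit. -/
theorem risk_comp_featureMap_le [IsProbabilityMeasure P] (hN : 0 < N) (hs : s = 1 / (N : ℝ))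
    (hS : ∀ i, S i ∈ unitCube n) (hSμ : ∀ i, S i ∈ P.fst.support) (hB : riskB s P = 0)
    {Z : Fin ml → EuclideanSpace ℝ (Fin n) × Fin 2} (hZreg : ∀ j, IsRegularPoint s P (Z j))
    {hZ : EuclideanSpace ℝ (regions s S) → Fin 2}
    (herm : IsERM (linearClassifiers (regions s S))
      (fun i => (featureMap (regions s S) (Z i).1, (Z i).2)) hZ) :
    risk P (hZ ∘ featureMap (regions s S)) ≤ P.fst.real (⋃ A ∈ regions s S, A)ᶜ
      + ∑ A ∈ regions s S with ∀ j, Z j ∉ Prod.fst ⁻¹' A, P.real (Prod.fst ⁻¹' A) := by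
  have hdisj : ∀ A ∈ regions s S, ∀ B ∈ regions s S, ∀ x, x ∈ A → x ∈ B → A = B :=
    fun A hA B hB x => eq_of_mem_regions hN hs hS hA hB
  have hpure : ∀ A ∈ regions s S, ∀ j k, (Z j).1 ∈ A → (Z k).1 ∈ A → (Z j).2 = (Z k).2 := by
    intro A hA j k hj hk
    by_contra hne
    exact (hZreg k).measure_region_ne_zero hA hk <| measure_region_label_eq_zero hN hs hS hSμ hB hA
      hne ((hZreg j).measure_region_ne_zero hA hj)
  set U : Set (EuclideanSpace ℝ (Fin n)) := ⋃ A ∈ regions s S, A with hU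
  have hUm : MeasurableSet U :=
    Finset.measurableSet_biUnion _ fun A hA => measurableSet_of_mem_regions hA
  set F := (regions s S).filter fun A => ∀ j, Z j ∉ Prod.fst ⁻¹' A with hF
  -- The null set of wrong labels: errors in regions that the labeled sample hits all lie in it.
  let W : Set (EuclideanSpace ℝ (Fin n) × Fin 2) := ⋃ A ∈ regions s S, ⋃ y : Fin 2,
    if P (A ×ˢ {y}) = 0 then A ×ˢ {y} else ∅
  have hW : P W = 0 := by
    refine (measure_biUnion_null_iff (regions s S).countable_toSet).2 fun A _ => ?_
    refine measure_iUnion_null fun y => ?_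
    split_ifs with h
    · exact h
    · exact measure_empty
  have hmeas : Measurable (hZ ∘ featureMap (regions s S)) :=
    (measurable_of_mem_linearClassifiers herm.1).comp
      (measurable_featureMap fun A hA => measurableSet_of_mem_regions hA)
  rw [risk_eq_measureReal P hmeas]
  have hsub : errorSet (hZ ∘ featureMap (regions s S))
      ⊆ (Prod.fst ⁻¹' Uᶜ ∪ ⋃ A ∈ F, Prod.fst ⁻¹' A) ∪ W := by
    intro z hz
    by_cases hzU : z.1 ∈ U
    swap
    · exact Or.inl (Or.inl hzU)
    obtain ⟨A, hA, hzA⟩ := Set.mem_iUnion₂.1 hzU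
    by_cases hAF : ∀ j, Z j ∉ Prod.fst ⁻¹' A
    · exact Or.inl (Or.inr (Set.mem_iUnion₂.2 ⟨A, Finset.mem_filter.2 ⟨hA, hAF⟩, hzA⟩))
    push Not at hAF
    obtain ⟨j, hj⟩ := hAF
    have h1 := herm.eq_label_of_mem hdisj hpure hA hj
    have h2 : hZ (featureMap (regions s S) z.1) = (Z j).2 := by
      rw [featureMap_eq_of_mem hdisj hA hzA hj, h1]
    have h3 : (Z j).2 ≠ z.2 := fun h => hz (h2.trans h)
    have h4 : P (A ×ˢ {z.2}) = 0 := measure_region_label_eq_zero hN hs hS hSμ hB hA h3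
      ((hZreg j).measure_region_ne_zero hA hj)
    refine Or.inr (Set.mem_iUnion₂.2 ⟨A, hA, Set.mem_iUnion.2 ⟨z.2, ?_⟩⟩)
    rw [if_pos h4]
    exact ⟨hzA, rfl⟩
  calc P.real (errorSet (hZ ∘ featureMap (regions s S)))
      ≤ P.real ((Prod.fst ⁻¹' Uᶜ ∪ ⋃ A ∈ F, Prod.fst ⁻¹' A) ∪ W) := measureReal_mono hsub
    _ ≤ P.real (Prod.fst ⁻¹' Uᶜ) + P.real (⋃ A ∈ F, Prod.fst ⁻¹' A) + P.real W :=
        (measureReal_union_le _ _).trans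
          (add_le_add_left (measureReal_union_le _ _) _)
    _ ≤ P.fst.real Uᶜ + ∑ A ∈ F, P.real (Prod.fst ⁻¹' A) := by
        have hW' : P.real W = 0 := by simp [measureReal_def, hW]
        have hU' : P.real (Prod.fst ⁻¹' Uᶜ) = P.fst.real Uᶜ := by
          rw [measureReal_def, measureReal_def, Measure.fst_apply hUm.compl]
        rw [hW', hU', add_zero]
        exact add_le_add_right (measureReal_biUnion_finset_le _ _) _

theorem pairRisk_nonneg (A B : Set (EuclideanSpace ℝ (Fin n)))
    (h : EuclideanSpace ℝ (Fin n) → Fin 2) : 0 ≤ pairRisk S A B h :=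
  div_nonneg (Finset.sum_nonneg fun _ _ => zeroOneLoss_nonneg _ _) (Nat.cast_nonneg m)

/-- The least pairwise error bounds the empirical risk from below, if there are regions of both
labels. -/
theorem pairBeta_le_empRisk {Xa : Finset (Set (EuclideanSpace ℝ (Fin n)))} {y : Fin m → Fin 2}
    {A B : Set (EuclideanSpace ℝ (Fin n))} (hA : A ∈ Xa) (hB : B ∈ Xa) (hAB : A ≠ B)
    (hyA : ∀ i, S i ∈ A → y i = 1) (hyB : ∀ i, S i ∈ B → y i = 0)
    {h : EuclideanSpace ℝ (Fin n) → Fin 2} (hh : h ∈ linearClassifiers (Fin n)) :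
    pairBeta S Xa ≤ empRisk (fun i => (S i, y i)) h := by
  classical
  have h1 : pairBeta S Xa ≤ pairRisk S A B h := by
    refine csInf_le ⟨0, ?_⟩ ⟨A, hA, B, hB, hAB, h, hh, rfl⟩
    rintro _ ⟨A, _, B, _, _, h, _, rfl⟩
    exact pairRisk_nonneg A B h
  refine h1.trans ?_
  unfold pairRisk empRisk
  refine div_le_div_of_nonneg_right ?_ (Nat.cast_nonneg m)
  calc _ ≤ ∑ i with S i ∈ A ∪ B, zeroOneLoss (h (S i)) (y i) := by
        refine Finset.sum_le_sum fun i hi => le_of_eq ?_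
        congr 1
        split_ifs with hiA
        · exact (hyA i hiA).symm
        · exact (hyB i (((Finset.mem_filter.1 hi).2).resolve_left hiA)).symm
    _ ≤ _ := Finset.sum_le_sum_of_subset_of_nonneg (Finset.filter_subset _ _)
        fun _ _ _ => zeroOneLoss_nonneg _ _

/-- A label of mass greater than the uncovered mass occurs in some region. -/
theorem exists_region_of_label {y : Fin 2}
    (hy : P.fst (⋃ A ∈ regions s S, A)ᶜ < P {z | z.2 = y}) :
    ∃ A ∈ regions s S, P (A ×ˢ {y}) ≠ 0 := by
  by_contra! hno
  refine absurd hy (not_lt.2 ?_)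
  have hUm : MeasurableSet (⋃ A ∈ regions s S, A) :=
    Finset.measurableSet_biUnion _ fun A hA => measurableSet_of_mem_regions hA
  have hnull : P (⋃ A ∈ regions s S, A ×ˢ ({y} : Set (Fin 2))) = 0 :=
    (measure_biUnion_null_iff (regions s S).countable_toSet).2 hno
  calc P {z | z.2 = y}
      ≤ P (Prod.fst ⁻¹' (⋃ A ∈ regions s S, A)ᶜ ∪ ⋃ A ∈ regions s S, A ×ˢ ({y} : Set (Fin 2))) := by
        refine measure_mono fun z hz => ?_
        by_cases hzU : z.1 ∈ ⋃ A ∈ regions s S, A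
        · obtain ⟨A, hA, hzA⟩ := Set.mem_iUnion₂.1 hzU
          exact Or.inr (Set.mem_iUnion₂.2 ⟨A, hA, hzA, hz⟩)
        · exact Or.inl hzU
    _ ≤ P (Prod.fst ⁻¹' (⋃ A ∈ regions s S, A)ᶜ) + 0 := (measure_union_le _ _).trans_eq (by rw [hnull])
    _ = _ := by rw [add_zero, Measure.fst_apply hUm.compl]

end ClusterLearning

/-! ### The comparison of the risks -/

namespace ClusterLearning

variable {n mu ml N : ℕ} {s δ εE : ℝ} {S : Fin mu → EuclideanSpace ℝ (Fin n)}
  {P : Measure (EuclideanSpace ℝ (Fin n) × Fin 2)}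

theorem epsA_nonneg (hs : s = 1 / (N : ℝ)) (hδ : 0 < δ) (hδ1 : δ < 1) : 0 ≤ epsA n mu s δ := by
  have hs0 : 0 ≤ s := by rw [hs]; positivity
  have h1 : 0 ≤ Real.log 2 := Real.log_nonneg (by norm_num)
  have h2 : 0 ≤ Real.log (3 / δ) := Real.log_nonneg (by rw [le_div_iff₀ hδ]; linarith)
  unfold epsA
  positivity

/-- Here `N ^ n ≥ 2 ^ n ≥ 2 * n ≥ 4 * mu` and `log 2 ≥ 1 / 2`. This settles the range `2 * mu ≤ n`,
where the growth bound is not available. -/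
theorem two_le_epsA (hN : 2 ≤ N) (hs : s = 1 / (N : ℝ)) (hδ : 0 < δ) (hδ1 : δ < 1)
    (hmu : 0 < mu) (hn : 2 * mu ≤ n) : 2 ≤ epsA n mu s δ := by
  have hmu' : (0 : ℝ) < mu := by exact_mod_cast hmu
  have h1 := Real.log_two_gt_d9
  have h2 : 0 ≤ Real.log (3 / δ) := Real.log_nonneg (by rw [le_div_iff₀ hδ]; linarith)
  have h3 : (s ^ n)⁻¹ = (N : ℝ) ^ n := by rw [hs, one_div, inv_pow, inv_inv]
  have h4 : 2 * n ≤ N ^ n := by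
    obtain ⟨k, rfl⟩ : ∃ k, n = k + 1 := ⟨n - 1, by omega⟩
    calc 2 * (k + 1) ≤ 2 * 2 ^ k := Nat.mul_le_mul_left 2 Nat.lt_two_pow_self
      _ = 2 ^ (k + 1) := by ring
      _ ≤ N ^ (k + 1) := Nat.pow_le_pow_left hN _
  have h5 : (2 * n : ℝ) ≤ (N : ℝ) ^ n := by exact_mod_cast h4
  have h6 : (2 * mu : ℝ) ≤ n := by exact_mod_cast hn
  rw [epsA, le_div_iff₀ hmu', h3]
  nlinarith

/-- `ε_A` is calibrated to the union bound over all sets of the `N ^ n` cells. -/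
theorem two_pow_mul_exp_neg_epsA (hs : s = 1 / (N : ℝ)) (hδ : 0 < δ) (hmu : 0 < mu) :
    (2 : ℝ) ^ N ^ n * Real.exp (-(mu * epsA n mu s δ)) = δ / 3 := by
  have hmu' : (mu : ℝ) ≠ 0 := by exact_mod_cast hmu.ne'
  have h3 : (s ^ n)⁻¹ = ((N ^ n : ℕ) : ℝ) := by rw [hs, one_div, inv_pow, inv_inv, Nat.cast_pow]
  rw [epsA, mul_div_cancel₀ _ hmu', h3, neg_add, Real.exp_add, Real.exp_neg, Real.exp_neg,
    Real.exp_nat_mul, Real.exp_log (by norm_num), Real.exp_log (by positivity)]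
  field_simp

open Classical in
/-- The samples for which the risks are compared without exceptions. -/
structure IsTypicalSample (s δ : ℝ) (P : Measure (EuclideanSpace ℝ (Fin n) × Fin 2))
    (S : Fin mu → EuclideanSpace ℝ (Fin n)) (y : Fin mu → Fin 2)
    (Z : Fin ml → EuclideanSpace ℝ (Fin n) × Fin 2) : Prop where
  regular : ∀ i, IsRegularPoint s P (S i, y i)
  regular' : ∀ j, IsRegularPoint s P (Z j)
  covered : P.fst {x | ∀ i, gridIdx s x ≠ gridIdx s (S i)} ≤ ENNReal.ofReal (epsA n mu s δ)
  seen : ∑ A ∈ regions s S with ∀ j, Z j ∉ Prod.fst ⁻¹' A, P.real (Prod.fst ⁻¹' A)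
    ≤ alphaBound (regions s S).card ml δ
  deviation : n + 1 ≤ 2 * mu → ∀ h ∈ linearClassifiers (Fin n),
    empRisk (fun i => (S i, y i)) h ≤ risk P h + vcWidth n mu δ

variable {y : Fin mu → Fin 2} {Z : Fin ml → EuclideanSpace ℝ (Fin n) × Fin 2}

theorem IsTypicalSample.measure_compl_regions_le (hyp : IsTypicalSample s δ P S y Z)
    (hcube : ∀ᵐ z ∂P, z.1 ∈ unitCube n) :
    P.fst (⋃ A ∈ regions s S, A)ᶜ ≤ ENNReal.ofReal (epsA n mu s δ) := by
  refine (ClusterLearning.measure_compl_regions_le ?_).trans hyp.covered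
  exact (ae_map_iff measurable_fst.aemeasurable measurableSet_unitCube).2 hcube

theorem IsTypicalSample.riskB_eq_zero (hyp : IsTypicalSample s δ P S y Z) (hN : 0 < N)
    (hs : s = 1 / (N : ℝ)) (hcube : ∀ᵐ z ∂P, z.1 ∈ unitCube n)
    (hB : riskA s P.fst ≤ ENNReal.ofReal (epsA n mu s δ) → riskB s P = 0)
    (hcard : 2 ≤ (regions s S).card) : riskB s P = 0 :=
  hB <| (riskA_le_measure_compl hN hs (fun i => (hyp.regular i).1)
    (fun i => (hyp.regular i).2.1) hcard).trans (hyp.measure_compl_regions_le hcube)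

theorem IsTypicalSample.risk_comp_featureMap_le [IsProbabilityMeasure P]
    (hyp : IsTypicalSample s δ P S y Z) (hN : 0 < N) (hs : s = 1 / (N : ℝ))
    (hδ : 0 < δ) (hδ1 : δ < 1) (hcube : ∀ᵐ z ∂P, z.1 ∈ unitCube n) (hB : riskB s P = 0)
    {hZ : EuclideanSpace ℝ (regions s S) → Fin 2}
    (herm : IsERM (linearClassifiers (regions s S))
      (fun i => (featureMap (regions s S) (Z i).1, (Z i).2)) hZ) :
    risk P (hZ ∘ featureMap (regions s S)) ≤ epsMaxZ n mu ml (regions s S).card s δ := by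
  refine (ClusterLearning.risk_comp_featureMap_le hN hs (fun i => (hyp.regular i).1)
    (fun i => (hyp.regular i).2.1) hB hyp.regular' herm).trans ?_
  refine add_le_add ?_ hyp.seen
  exact ENNReal.toReal_le_of_le_ofReal (epsA_nonneg hs hδ hδ1)
    (hyp.measure_compl_regions_le hcube)

/-- A lower bound `β` on the empirical risk with the true labels lets one compare the risks. -/
theorem IsTypicalSample.epsMin_sub_le [IsProbabilityMeasure P]
    (hyp : IsTypicalSample s δ P S y Z) (hN : 0 < N) (hs : s = 1 / (N : ℝ))
    (hδ : 0 < δ) (hδ1 : δ < 1) (hcube : ∀ᵐ z ∂P, z.1 ∈ unitCube n) (hB : riskB s P = 0)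
    (hcard : 2 ≤ (regions s S).card) {h : EuclideanSpace ℝ (Fin n) → Fin 2}
    (hh : h ∈ linearClassifiers (Fin n)) {hZ : EuclideanSpace ℝ (regions s S) → Fin 2}
    (herm : IsERM (linearClassifiers (regions s S))
      (fun i => (featureMap (regions s S) (Z i).1, (Z i).2)) hZ)
    {β : ℝ} (hβ : β ≤ empRisk (fun i => (S i, y i)) h) :
    epsMin n mu δ β - epsMaxZ n mu ml (regions s S).card s δ
      ≤ risk P h - risk P (hZ ∘ featureMap (regions s S)) := by
  have hmin : epsMin n mu δ β = β - vcWidth n mu δ := rfl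
  have hZle := hyp.risk_comp_featureMap_le hN hs hδ hδ1 hcube hB herm
  rw [hmin]
  by_cases hn : n + 1 ≤ 2 * mu
  · linarith [hyp.deviation hn h hh]
  -- With so few points `ε_A ≥ 2`, so the left side is at most `-1`, below any difference of risks.
  · have hmu : 0 < mu := by
      have := hcard.trans (card_regions_le (s := s) (S := S))
      omega
    have h2 : 2 ≤ epsA n mu s δ := two_le_epsA
      (two_le_of_two_le_card_regions hN hs (fun i => (hyp.regular i).1) hcard) hs hδ hδ1 hmu
      (by omega)
    have h3 : 0 ≤ alphaBound (regions s S).card ml δ := alphaBound_nonneg hδ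
    have h4 : 0 ≤ vcWidth n mu δ := Real.sqrt_nonneg _
    have h5 := empRisk_le_one (fun i => (S i, y i)) h
    have h6 := risk_nonneg P h
    have h7 : risk P (hZ ∘ featureMap (regions s S)) ≤ 1 := by
      rw [risk_eq_measureReal]
      · exact measureReal_le_one
      · exact (measurable_of_mem_linearClassifiers herm.1).comp
          (measurable_featureMap fun A hA => measurableSet_of_mem_regions hA)
    unfold epsMaxZ
    linarith

/-- `P` itself makes `y` admissible. The bound holds for a minimizer on `S`, hence for every linear
`h`, wherever it was learned. -/
theorem IsTypicalSample.le_empRisk_of_isEmpRiskLowerBound [IsProbabilityMeasure P]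
    (hyp : IsTypicalSample s δ P S y Z) (hB : riskB s P = 0) (hE : LabelBalanced εE P)
    {β : ℝ} (hβ : IsEmpRiskLowerBound s εE P.fst S β) {h : EuclideanSpace ℝ (Fin n) → Fin 2}
    (hh : h ∈ linearClassifiers (Fin n)) : β ≤ empRisk (fun i => (S i, y i)) h := by
  obtain ⟨g, hg⟩ := exists_isERM ⟨h, hh⟩ (fun i => (S i, y i))
  exact (hβ y ⟨P, inferInstance, rfl, hB, hE, fun i => (hyp.regular i).2.2.1⟩ g hg).trans
    (hg.2 h hh)

/-- Each label has mass at least `ε_E`, more than the uncovered mass, so it occurs in a region.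
Purity makes the two regions distinct and fixes the sample labels in them. -/
theorem IsTypicalSample.pairBeta_le_empRisk [IsProbabilityMeasure P]
    (hyp : IsTypicalSample s δ P S y Z) (hN : 0 < N) (hs : s = 1 / (N : ℝ))
    (hcube : ∀ᵐ z ∂P, z.1 ∈ unitCube n) (hB : riskB s P = 0) (hE : LabelBalanced εE P)
    (hεE : 0 < εE) (hlt : epsA n mu s δ < εE) {h : EuclideanSpace ℝ (Fin n) → Fin 2}
    (hh : h ∈ linearClassifiers (Fin n)) :
    pairBeta S (regions s S) ≤ empRisk (fun i => (S i, y i)) h := by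
  have hS : ∀ i, S i ∈ unitCube n := fun i => (hyp.regular i).1
  have hSμ : ∀ i, S i ∈ P.fst.support := fun i => (hyp.regular i).2.1
  have h1 : P.fst (⋃ A ∈ regions s S, A)ᶜ < P {z | z.2 = 1} :=
    ((hyp.measure_compl_regions_le hcube).trans_lt
      ((ENNReal.ofReal_lt_ofReal_iff hεE).2 hlt)).trans_le hE.2
  obtain ⟨A, hA, hA1⟩ := exists_region_of_label h1
  obtain ⟨B, hB', hB0⟩ := exists_region_of_label (h1.trans_le hE.1)
  have hlabel : ∀ {A : Set (EuclideanSpace ℝ (Fin n))} {c : Fin 2}, A ∈ regions s S →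
      P (A ×ˢ {c}) ≠ 0 → ∀ i, S i ∈ A → y i = c := by
    intro A c hA hAc i hi
    by_contra hne
    exact (hyp.regular i).measure_region_ne_zero hA hi
      (measure_region_label_eq_zero hN hs hS hSμ hB hA (Ne.symm hne) hAc)
  refine ClusterLearning.pairBeta_le_empRisk hA hB' ?_ (hlabel hA hA1) (hlabel hB' hB0) hh
  rintro rfl
  exact hB0 (measure_region_label_eq_zero hN hs hS hSμ hB hA (by decide) hA1)

/-! ### Probability of the exceptional samples -/

theorem measure_pi_exists_not_eq_zero {X : Type*} [MeasurableSpace X] (μ : Measure X)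
    [IsProbabilityMeasure μ] {p : X → Prop} (hp : ∀ᵐ x ∂μ, p x) (m : ℕ) :
    Measure.pi (fun _ : Fin m => μ) {S | ¬ ∀ i, p (S i)} = 0 := by
  have : {S : Fin m → X | ¬ ∀ i, p (S i)} = ⋃ i, Function.eval i ⁻¹' {x | ¬ p x} := by
    ext; simp
  rw [this]
  exact measure_iUnion_null fun i => Measure.pi_eval_preimage_null _ hp

theorem regions_eq_of_gridIdx_eq {S S' : Fin mu → EuclideanSpace ℝ (Fin n)}
    (h1 : ∀ i, gridIdx s (S i) = gridIdx s (S' i))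
    (h2 : ∀ i j, dist (S i) (S j) ≤ sepParam n s ↔ dist (S' i) (S' j) ≤ sepParam n s) :
    regions s S = regions s S' := by
  have hG : sampleGraph s S = sampleGraph s S' := by
    ext i j
    exact and_congr_right fun _ => h2 i j
  have hR : region s S = region s S' := by
    funext i
    unfold region
    rw [hG]
    exact Set.iUnion₂_congr fun j _ => cell_eq_of_gridIdx_eq (h1 j)
  unfold regions
  rw [hR]

/-- What the regions depend on: the hypercubes of the points and the edges of the graph. -/
noncomputable def regionStatistic (s : ℝ) (S : Fin mu → EuclideanSpace ℝ (Fin n)) :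
    (Fin mu → Fin n → ℕ) × (Fin mu → Fin mu → Prop) :=
  (fun i => gridIdx s (S i), fun i j => dist (S i) (S j) ≤ sepParam n s)

theorem measurableSet_regionStatistic_preimage (s : ℝ)
    (t : (Fin mu → Fin n → ℕ) × (Fin mu → Fin mu → Prop)) :
    MeasurableSet (regionStatistic (n := n) s ⁻¹' {t}) := by
  have h : regionStatistic (n := n) s ⁻¹' {t}
      = (⋂ i, {S | gridIdx s (S i) = t.1 i})
        ∩ ⋂ i, ⋂ j, {S | dist (S i) (S j) ≤ sepParam n s ↔ t.2 i j} := by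
    ext S
    simp [regionStatistic, Prod.ext_iff, funext_iff]
  rw [h]
  refine (MeasurableSet.iInter fun i => ?_).inter
    (MeasurableSet.iInter fun i => MeasurableSet.iInter fun j => ?_)
  · exact (measurable_gridIdx s).comp (measurable_pi_apply i) (measurableSet_singleton (t.1 i))
  · have hd : MeasurableSet {S : Fin mu → EuclideanSpace ℝ (Fin n) |
        dist (S i) (S j) ≤ sepParam n s} :=
      measurableSet_le ((measurable_pi_apply i).dist (measurable_pi_apply j)) measurable_const
    by_cases ht : t.2 i j
    · simpa only [ht, iff_true] using hd
    · simp only [ht, iff_false]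
      exact hd.compl

-- For fixed `S` this is the bound for a fixed finite family. The regions vary with `S` through a
-- statistic with countably many values, which permits integration over `S`.
open Classical in
theorem measure_unseen_regions_le (s : ℝ) (P : Measure (EuclideanSpace ℝ (Fin n) × Fin 2))
    [IsProbabilityMeasure P] (mu ml : ℕ) {δ : ℝ} (hδ : 0 < δ) :
    ((Measure.pi fun _ : Fin mu => P.fst).prod (Measure.pi fun _ : Fin ml => P))
      {ω | alphaBound (regions s ω.1).card ml δ
        < ∑ A ∈ regions s ω.1 with ∀ j, ω.2 j ∉ Prod.fst ⁻¹' A, P.real (Prod.fst ⁻¹' A)}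
      ≤ ENNReal.ofReal (δ / 3) := by
  refine measure_prod_le_of_statistic _ _ (regionStatistic s)
    (measurableSet_regionStatistic_preimage s) ?_ fun S => ?_
  · intro S S' hSS' Z hZ
    have hreg : regions s S = regions s S' := by
      rw [regionStatistic, regionStatistic, Prod.mk.injEq] at hSS'
      exact regions_eq_of_gridIdx_eq (fun i => congrFun hSS'.1 i)
        fun i j => iff_of_eq (congrFun (congrFun hSS'.2 i) j)
    simpa only [Set.mem_ofPred_eq, hreg] using hZ
  · exact measure_unseen_mass_gt_le P (regions s S) (fun A => Prod.fst ⁻¹' A)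
      (fun A hA => measurable_fst (measurableSet_of_mem_regions hA)) ml hδ

theorem measure_uncovered_grid_le (hN : 0 < N) (hs : s = 1 / (N : ℝ))
    (μ : Measure (EuclideanSpace ℝ (Fin n))) [IsProbabilityMeasure μ] (hmu : 0 < mu)
    (hδ : 0 < δ) :
    Measure.pi (fun _ : Fin mu => μ)
      {S | ENNReal.ofReal (epsA n mu s δ) < μ {x | ∀ i, gridIdx s x ≠ gridIdx s (S i)}}
      ≤ ENNReal.ofReal (δ / 3) := by
  have key := measure_uncovered_gt_le μ (gridIdx s)
    (fun V => measurable_gridIdx s (Set.to_countable V).measurableSet)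
    (Fintype.piFinset fun _ : Fin n => Finset.range N)
    (fun x => Fintype.mem_piFinset.2 fun i => Finset.mem_range.2 (gridIndex_lt hN hs (x i)))
    mu (epsA n mu s δ)
  rwa [Fintype.card_piFinset_const, Finset.card_range, two_pow_mul_exp_neg_epsA hs hδ hmu] at key

/-- Labels drawn from `P` are almost surely regular, so if all regular labelings of `S` deviate, the
random one does. -/
theorem measure_atypical_labeling_le [IsProbabilityMeasure P]
    (hcube : ∀ᵐ z ∂P, z.1 ∈ unitCube n) (hmu : 0 < mu) (hδ : 0 < δ) (hδ1 : δ < 1) :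
    Measure.pi (fun _ : Fin mu => P.fst)
      {S | ∀ y : Fin mu → Fin 2, (∀ i, IsRegularPoint s P (S i, y i)) → n + 1 ≤ 2 * mu ∧
        ∃ h ∈ linearClassifiers (Fin n),
          risk P h + vcWidth n mu δ < empRisk (fun i => (S i, y i)) h}
      ≤ ENNReal.ofReal (δ / 6) := by
  let G : Set (Fin mu → EuclideanSpace ℝ (Fin n) × Fin 2) :=
    {z | ¬ ∀ i, IsRegularPoint s P (z i)} ∪ {z | n + 1 ≤ 2 * mu ∧
      ∃ h ∈ linearClassifiers (Fin n), risk P h + vcWidth n mu δ < empRisk z h}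
  refine (measure_mono (t := {S | ∀ y : Fin mu → Fin 2, (fun i => (S i, y i)) ∈ G})
    ?_).trans ?_
  · exact fun S hS y => or_iff_not_imp_left.2 fun h => hS y (not_not.1 h)
  calc _
    _ ≤ Measure.pi (fun _ : Fin mu => P) G := measure_forall_labeling_le P G
    _ ≤ 0 + ENNReal.ofReal (δ / 6) := by
        refine (measure_union_le _ _).trans (add_le_add ?_ ?_)
        · exact (measure_pi_exists_not_eq_zero P (ae_isRegularPoint s P hcube) mu).le
        · by_cases hn : n + 1 ≤ 2 * mu
          · refine (measure_mono ?_).trans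
              (measure_exists_linear_deviation_le P hmu hn hδ hδ1)
            exact fun z hz => hz.2
          · simp [hn]
    _ = _ := zero_add _

end ClusterLearning

open ClusterLearning in
theorem theorem3 (n mu ml N : ℕ) (s δ εE : ℝ) (hN : 0 < N) (hs : s = 1 / (N : ℝ))
    (hδ : 0 < δ) (hεE : 0 < εE) (hεE' : εE ≤ 1 / 2)
    (P : MeasureTheory.Measure (EuclideanSpace ℝ (Fin n) × Fin 2))
    [MeasureTheory.IsProbabilityMeasure P]
    (hcube : ∀ᵐ z ∂P, z.1 ∈ unitCube n)
    (hB : riskA s P.fst ≤ ENNReal.ofReal (epsA n mu s δ) → riskB s P = 0)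
    (hE : LabelBalanced εE P) :
    ((MeasureTheory.Measure.pi fun _ : Fin mu => P.fst).prod
        (MeasureTheory.Measure.pi fun _ : Fin ml => P))
      {ω | ¬ ∀ Xa : Finset (Set (EuclideanSpace ℝ (Fin n))),
          clusterTest s ω.1 = some (Xa, 0) →
          ∀ h, IsERM (linearClassifiers (Fin n)) ω.2 h →
          ∀ hZ, IsERM (linearClassifiers Xa) (fun i => (featureMap Xa (ω.2 i).1, (ω.2 i).2)) hZ →
            (∀ β, IsEmpRiskLowerBound s εE P.fst ω.1 β →
              epsMin n mu δ β - epsMaxZ n mu ml Xa.card s δ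
                ≤ risk P h - risk P (hZ ∘ featureMap Xa)) ∧
            (epsA n mu s δ < εE →
              epsMin n mu δ (pairBeta ω.1 Xa) - epsMaxZ n mu ml Xa.card s δ
                ≤ risk P h - risk P (hZ ∘ featureMap Xa))}
      ≤ ENNReal.ofReal δ := by
  classical
  rcases le_or_gt 1 δ with hδ1 | hδ1
  · exact prob_le_one.trans (by rwa [ENNReal.one_le_ofReal])
  have htest : ∀ {S : Fin mu → EuclideanSpace ℝ (Fin n)} {Xa},
      clusterTest s S = some (Xa, 0) → Xa = regions s S ∧ 2 ≤ (regions s S).card := by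
    intro S Xa h
    unfold clusterTest at h
    split_ifs at h with hcard
    simp only [Option.some.injEq, Prod.mk.injEq, and_true] at h
    exact ⟨h.symm, hcard⟩
  rcases Nat.eq_zero_or_pos mu with rfl | hmu
  · refine (measure_mono (t := ∅) fun ω hω => (hω fun Xa hXa => ?_).elim).trans (by simp)
    have h1 := (htest hXa).2
    have h2 := card_regions_le (s := s) (S := ω.1)
    omega
  set μu := Measure.pi fun _ : Fin mu => P.fst
  set μl := Measure.pi fun _ : Fin ml => P
  let E₁ : Set (Fin mu → EuclideanSpace ℝ (Fin n)) :=
    {S | ∀ y : Fin mu → Fin 2, (∀ i, IsRegularPoint s P (S i, y i)) → n + 1 ≤ 2 * mu ∧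
      ∃ h ∈ linearClassifiers (Fin n),
        risk P h + vcWidth n mu δ < empRisk (fun i => (S i, y i)) h}
  let E₂ : Set (Fin mu → EuclideanSpace ℝ (Fin n)) :=
    {S | ENNReal.ofReal (epsA n mu s δ) < P.fst {x | ∀ i, gridIdx s x ≠ gridIdx s (S i)}}
  let E₃ : Set ((Fin mu → EuclideanSpace ℝ (Fin n)) ×
      (Fin ml → EuclideanSpace ℝ (Fin n) × Fin 2)) :=
    {ω | alphaBound (regions s ω.1).card ml δ
      < ∑ A ∈ regions s ω.1 with ∀ j, ω.2 j ∉ Prod.fst ⁻¹' A, P.real (Prod.fst ⁻¹' A)}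
  let E₄ : Set (Fin ml → EuclideanSpace ℝ (Fin n) × Fin 2) :=
    {Z | ¬ ∀ j, IsRegularPoint s P (Z j)}
  have hE₁ : μu E₁ ≤ ENNReal.ofReal (δ / 6) := measure_atypical_labeling_le hcube hmu hδ hδ1
  have hE₂ : μu E₂ ≤ ENNReal.ofReal (δ / 3) := measure_uncovered_grid_le hN hs P.fst hmu hδ
  have hE₃ : (μu.prod μl) E₃ ≤ ENNReal.ofReal (δ / 3) := measure_unseen_regions_le s P mu ml hδ
  have hE₄ : μl E₄ = 0 := measure_pi_exists_not_eq_zero P (ae_isRegularPoint s P hcube) ml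
  calc _ ≤ (μu.prod μl) (((E₁ ×ˢ Set.univ ∪ E₂ ×ˢ Set.univ) ∪ E₃) ∪ Set.univ ×ˢ E₄) := by
        refine measure_mono fun ω hω => ?_
        by_contra hgood
        simp only [Set.mem_union, Set.mem_prod, Set.mem_univ, and_true, true_and, not_or]
          at hgood
        obtain ⟨⟨⟨h1, h2⟩, h3⟩, h4⟩ := hgood
        refine hω fun Xa hXa h hh hZ herm => ?_
        obtain ⟨rfl, hcard⟩ := htest hXa
        simp only [E₁, Set.mem_ofPred_eq] at h1
        push Not at h1
        -- These labels of the unlabeled sample are only shown to exist; they depend on the sample.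
        obtain ⟨y, hy, hdev⟩ := h1
        have hyp : IsTypicalSample s δ P ω.1 y ω.2 :=
          ⟨hy, not_not.1 h4, not_lt.1 h2, not_lt.1 h3, hdev⟩
        have hB0 := hyp.riskB_eq_zero hN hs hcube hB hcard
        exact ⟨fun β hβ => hyp.epsMin_sub_le hN hs hδ hδ1 hcube hB0 hcard hh.1 herm
            (hyp.le_empRisk_of_isEmpRiskLowerBound hB0 hE hβ hh.1),
          fun hlt => hyp.epsMin_sub_le hN hs hδ hδ1 hcube hB0 hcard hh.1 herm
            (hyp.pairBeta_le_empRisk hN hs hcube hB0 hE hεE hlt hh.1)⟩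
    _ ≤ μu E₁ + μu E₂ + (μu.prod μl) E₃ + μl E₄ := by
        refine (measure_union_le _ _).trans (add_le_add ((measure_union_le _ _).trans
          (add_le_add ((measure_union_le _ _).trans (add_le_add ?_ ?_)) le_rfl)) ?_)
        all_goals simp [Measure.prod_prod]
    _ ≤ ENNReal.ofReal (δ / 6) + ENNReal.ofReal (δ / 3) + ENNReal.ofReal (δ / 3) + 0 := by
        gcongr
        exact hE₄.le
    -- The sum is `5δ/6`.
    _ ≤ ENNReal.ofReal δ := by
        rw [add_zero, ← ENNReal.ofReal_add (by positivity) (by positivity),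
          ← ENNReal.ofReal_add (by positivity) (by positivity)]
        exact ENNReal.ofReal_le_ofReal (by linarith)
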